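/- Let $\mathbb{H}$ be the first Heisenberg group, i.e. $\mathbb{R}^3$ with the product $(x,y,z)(x',y',z')=\bigl(x+x',\,y+y',\,z+z'+\tfrac12(xy'-x'y)\bigr)$ and the topology of $\mathbb{R}^3$. Let $|(x,y,z)|_K=\bigl((x^2+y^2)^2+16z^2\bigr)^{1/4}$ and $d(a,b)=|b^{-1}a|_K$, and write $d(p,W)=\inf_{w\in W}d(p,w)$. For $\lambda>0$, a set $E\subset\mathbb{H}$ is a *$\lambda$-vertical curve* if $E\subset p\,\{(x,y,z): |z|\ge\lambda(x^2+y^2)\}$ for all $p\in E$; a *vertical curve* is a set that is a $\lambda$-vertical curve for some $\lambda>0$. Write $p\prec q$ if the $z$-coordinate of $p^{-1}q$ is positive; $\prec$ is a total order on any connected vertical curve $E$, and the *endpoints* of $E$ are its first and last points with respect to $\prec$, if they exist. A *vertical plane* is a subgroup $W$ of $\mathbb{H}$ that is a two-dimensional linear subspace of $\mathbb{R}^3$ containing the center $\{(0,0,t):t\in\mathbb{R}\}$. Let $W^\perp$ be the set of all $(x,y,0)$ orthogonal to $W$; every $p\in\mathbb{H}$ is uniquely $p=wv$ with $w\in W$,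 $v\in W^\perp$, and we put $\Pi_W(p)=w$. For $L\in(0,1)$, a set $\Gamma\subset\mathbb{H}$ is an *$L$-intrinsic Lipschitz ($L$-iLip) graph over $W$* if $\Gamma\subset p\,\{q: d(q,W)\le L\,d(\mathbf 0,q)\}$ for all $p\in\Gamma$, and it is *entire* if moreover $\Pi_W(\Gamma)=W$. **Theorem.** Let $W_1\neq W_2$ be vertical planes. If $\lambda>0$ is sufficiently large (that is, for all $\lambda>\lambda_0$, for some $\lambda_0>0$ depending on $W_1,W_2$), then there are $L,L'\in(0,1)$ such that: 1. If $\Gamma_1$ and $\Gamma_2$ are entire $L$-iLip graphs over $W_1$ and $W_2$ respectively, then $\Gamma_1\cap\Gamma_2$ is a $\lambda$-vertical curve which is nonempty, closed, connected, and has no endpoints. 2. If $E$ is a $\lambda$-vertical curve, then there are entire $L'$-iLip graphs $\Gamma_1$ over $W_1$ and $\Gamma_2$ over $W_2$ such that $\Gamma_1\cap\Gamma_2$ is a vertical curve containing $E$; and if $E$ is nonempty, closed, connected, and has no endpoints, then $\Gamma_1\cap\Gamma_2=E$. -/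

import Mathlib

open scoped Pointwise

/-- The first Heisenberg group, in exponential coordinates `(x, y, z)`. -/
@[ext]
structure Heisenberg where
  x : ℝ
  y : ℝ
  z : ℝ

namespace Heisenberg

/-- The exponential coordinates, as a bijection with `ℝ³`. -/
def coords : Heisenberg ≃ ℝ × ℝ × ℝ where
  toFun p := (p.x, p.y, p.z)
  invFun v := ⟨v.1, v.2.1, v.2.2⟩
  left_inv _ := rfl
  right_inv _ := rfl

/-- The topology is that of `ℝ³`. -/
instance : TopologicalSpace Heisenberg := TopologicalSpace.induced coords inferInstance

noncomputable instance : Mul Heisenberg :=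
  ⟨fun p q => ⟨p.x + q.x, p.y + q.y, p.z + q.z + (1 / 2 : ℝ) * (p.x * q.y - q.x * p.y)⟩⟩

noncomputable instance : One Heisenberg := ⟨⟨0, 0, 0⟩⟩

noncomputable instance : Inv Heisenberg := ⟨fun p => ⟨-p.x, -p.y, -p.z⟩⟩

@[simp] theorem mul_x (p q : Heisenberg) : (p * q).x = p.x + q.x := rfl
@[simp] theorem mul_y (p q : Heisenberg) : (p * q).y = p.y + q.y := rfl
@[simp] theorem mul_z (p q : Heisenberg) :
    (p * q).z = p.z + q.z + (1 / 2 : ℝ) * (p.x * q.y - q.x * p.y) := rfl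
@[simp] theorem one_x : (1 : Heisenberg).x = 0 := rfl
@[simp] theorem one_y : (1 : Heisenberg).y = 0 := rfl
@[simp] theorem one_z : (1 : Heisenberg).z = 0 := rfl
@[simp] theorem inv_x (p : Heisenberg) : (p⁻¹).x = -p.x := rfl
@[simp] theorem inv_y (p : Heisenberg) : (p⁻¹).y = -p.y := rfl
@[simp] theorem inv_z (p : Heisenberg) : (p⁻¹).z = -p.z := rfl

/-- The group law `(x,y,z)(x',y',z') = (x + x', y + y', z + z' + (x y' - x' y)/2)`. -/
noncomputable instance : Group Heisenberg :=
  Group.ofLeftAxioms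
    (by intro a b c; ext <;> simp <;> ring)
    (by intro a; ext <;> simp)
    (by intro a; ext <;> simp)

/-- The Korányi norm `((x² + y²)² + 16 z²)^(1/4)`. -/
noncomputable def koranyiNorm (p : Heisenberg) : ℝ :=
  ((p.x ^ 2 + p.y ^ 2) ^ 2 + 16 * p.z ^ 2) ^ (1 / 4 : ℝ)

/-- The (left-invariant) Korányi distance `d(a, b) = |b⁻¹ a|`. -/
noncomputable def koranyiDist (a b : Heisenberg) : ℝ := koranyiNorm (b⁻¹ * a)

/-- The Korányi distance from a point to a subgroup (the infimum of a nonempty family of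
nonnegative reals). -/
noncomputable def koranyiDistTo (p : Heisenberg) (W : Subgroup Heisenberg) : ℝ :=
  ⨅ w : W, koranyiDist p w

/-- The vertical cone `{|z| ≥ lam (x² + y²)}`. -/
def vCone (lam : ℝ) : Set Heisenberg := {p | lam * (p.x ^ 2 + p.y ^ 2) ≤ |p.z|}

/-- `E` is a `lam`-vertical curve if `E ⊆ p VCone` for all `p ∈ E`. -/
def IsVerticalCurve (lam : ℝ) (E : Set Heisenberg) : Prop :=
  ∀ p ∈ E, E ⊆ p • vCone lam

/-- A vertical plane: a subgroup which, in exponential coordinates, is a two-dimensional linear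
subspace of `ℝ³`, and which contains the center `⟨Z⟩ = {(0, 0, t)}`. -/
def IsVerticalPlane (W : Subgroup Heisenberg) : Prop :=
  (∃ S : Submodule ℝ (ℝ × ℝ × ℝ), Module.finrank ℝ S = 2 ∧ coords '' (W : Set Heisenberg) = S) ∧
    ∀ t : ℝ, (⟨0, 0, t⟩ : Heisenberg) ∈ W

/-- The cone around `W`: the points `p` with `d(p, W) ≤ L d(0, p)`. -/
def cone (W : Subgroup Heisenberg) (L : ℝ) : Set Heisenberg :=
  {p | koranyiDistTo p W ≤ L * koranyiDist 1 p}

/-- `E` is an `L`-intrinsic Lipschitz graph over `W` if `E ⊆ p Cone` for all `p ∈ E`. -/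
def IsILipGraph (W : Subgroup Heisenberg) (L : ℝ) (E : Set Heisenberg) : Prop :=
  ∀ p ∈ E, E ⊆ p • cone W L

/-- The horizontal orthogonal complement `V = W^⊥`: the horizontal vectors `(x, y, 0)` that are
orthogonal to `W`. -/
def horizontalPerp (W : Subgroup Heisenberg) : Set Heisenberg :=
  {v | v.z = 0 ∧ ∀ w ∈ W, v.x * w.x + v.y * w.y = 0}

/-- The image `Π_W(E)` under the projection `Π_W : w v ↦ w` (`w ∈ W`, `v ∈ W^⊥`) of the splitting
`ℍ = W · W^⊥`. -/
def projImage (W : Subgroup Heisenberg) (E : Set Heisenberg) : Set Heisenberg :=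
  {w | w ∈ W ∧ ∃ v ∈ horizontalPerp W, w * v ∈ E}

/-- `E` is an entire `L`-intrinsic Lipschitz graph over `W`: moreover `Π_W(E) = W`. -/
def IsEntireILipGraph (W : Subgroup Heisenberg) (L : ℝ) (E : Set Heisenberg) : Prop :=
  IsILipGraph W L E ∧ projImage W E = (W : Set Heisenberg)

/-- The relation `p ≺ q`, i.e. `z(p⁻¹ q) > 0`; it is a total order on every connected vertical
curve. -/
def Prec (p q : Heisenberg) : Prop := 0 < (p⁻¹ * q).z

/-- `p` is an endpoint of `E` if it is the first or the last point of `E` in the order `≺`. For a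
connected vertical curve these are the images of the endpoints of the interval parametrizing it
(the point of a one-point curve is an endpoint). -/
def IsEndpoint (E : Set Heisenberg) (p : Heisenberg) : Prop :=
  p ∈ E ∧ ((∀ q ∈ E, q ≠ p → Prec p q) ∨ (∀ q ∈ E, q ≠ p → Prec q p))

/-- `E` has no endpoints. -/
def HasNoEndpoints (E : Set Heisenberg) : Prop := ∀ p, ¬ IsEndpoint E p

end Heisenberg

open Heisenberg

open Filter Topology
open scoped Pointwise

namespace Heisenberg

/-! ### Topology in coordinates -/

/-! Choose unit normals to the planes; the distance to a plane is then the absolute normal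
coordinate, and the determinant `D` of the normals is nonzero. Two normal coordinates control the
whole horizontal part (`sq_add_sq_mul_det_sq_le`).

Part 1. For small `L`, a displacement between two points of the intersection has both normal
coordinates small compared with its norm, so it is steep. Points of the intersection come from
Newton's method (`exists_newton_step`): a horizontal move correcting both normal errors at once
halves them. Started above or below a known point, it yields points at roughly every relative
height. This excludes endpoints, and it gives connectedness because a closest pair across a
separation would have a point between them (`false_of_disjoint_closed_cover`).

Part 2. An open cone `C` around the normal direction is a semigroup (`mul_mem_openCone`) and misses
the vertical cone when `lam` is large. The boundary of `E * C` is an entire graph through `E`. A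
displacement avoiding both cones and their inverses is steep, so the two boundaries meet in a
vertical curve. A closed connected curve without endpoints is maximal
(`IsVerticalCurve.eq_of_subset`): an extra point would either split it or, by compactness, create an
extremal point. -/

/-- The exponential coordinates as a homeomorphism with `ℝ³`. -/
def coordsHomeomorph : Heisenberg ≃ₜ ℝ × ℝ × ℝ :=
  coords.toHomeomorphOfIsInducing ⟨rfl⟩

theorem continuous_x : Continuous Heisenberg.x := continuous_fst.comp coordsHomeomorph.continuous

theorem continuous_y : Continuous Heisenberg.y :=
  (continuous_fst.comp continuous_snd).comp coordsHomeomorph.continuous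

theorem continuous_z : Continuous Heisenberg.z :=
  (continuous_snd.comp continuous_snd).comp coordsHomeomorph.continuous

theorem continuous_mk {X : Type*} [TopologicalSpace X] {f g h : X → ℝ} (hf : Continuous f)
    (hg : Continuous g) (hh : Continuous h) :
    Continuous fun t => (⟨f t, g t, h t⟩ : Heisenberg) :=
  coordsHomeomorph.symm.continuous.comp (hf.prodMk (hg.prodMk hh))

instance : ContinuousMul Heisenberg where
  continuous_mul := by
    have hx := continuous_x
    have hy := continuous_y
    have hz := continuous_z
    exact continuous_mk (f := fun p : Heisenberg × Heisenberg => p.1.x + p.2.x)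
      (g := fun p => p.1.y + p.2.y)
      (h := fun p => p.1.z + p.2.z + (1 / 2 : ℝ) * (p.1.x * p.2.y - p.2.x * p.1.y))
      (by fun_prop) (by fun_prop) (by fun_prop)

instance : ContinuousInv Heisenberg where
  continuous_inv := continuous_mk continuous_x.neg continuous_y.neg continuous_z.neg

theorem isCompact_box (p : Heisenberg) (R : ℝ) :
    IsCompact {q : Heisenberg | |(p⁻¹ * q).x| ≤ R ∧ |(p⁻¹ * q).y| ≤ R ∧ |(p⁻¹ * q).z| ≤ R} := by
  have h : IsCompact (Set.Icc (-R) R ×ˢ Set.Icc (-R) R ×ˢ Set.Icc (-R) R) :=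
    isCompact_Icc.prod (isCompact_Icc.prod isCompact_Icc)
  convert h.image ((continuous_const_mul p).comp coordsHomeomorph.symm.continuous) using 1
  ext q
  simp only [Set.mem_ofPred_eq, abs_le, Set.mem_image, Set.mem_prod, Set.mem_Icc]
  constructor
  · intro hq
    exact ⟨coordsHomeomorph (p⁻¹ * q), hq, by simp⟩
  · rintro ⟨v, hv, rfl⟩
    have : p⁻¹ * ((fun x => p * x) ∘ coordsHomeomorph.symm) v = coordsHomeomorph.symm v := by simp
    rw [this]
    exact hv

theorem inv_mul_z_comm (p q : Heisenberg) : (q⁻¹ * p).z = -(p⁻¹ * q).z := by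
  simp only [mul_z, inv_x, inv_y, inv_z]; ring

/-! ### Vertical curves -/

theorem isVerticalCurve_iff {lam : ℝ} {E : Set Heisenberg} :
    IsVerticalCurve lam E ↔ ∀ p ∈ E, ∀ q ∈ E, p⁻¹ * q ∈ vCone lam := by
  simp only [IsVerticalCurve, Set.subset_def, Set.mem_smul_set_iff_inv_smul_mem, smul_eq_mul]

theorem IsVerticalCurve.mono {lam : ℝ} {E F : Set Heisenberg} (hF : IsVerticalCurve lam F)
    (h : E ⊆ F) : IsVerticalCurve lam E := by
  rw [isVerticalCurve_iff] at *
  exact fun p hp q hq => hF p (h hp) q (h hq)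

theorem vCone_antitone {l m : ℝ} (h : l ≤ m) : vCone m ⊆ vCone l := fun p (hp : _ ≤ _) =>
  (mul_le_mul_of_nonneg_right h (by positivity : 0 ≤ p.x ^ 2 + p.y ^ 2)).trans hp

theorem IsVerticalCurve.of_le {l m : ℝ} {E : Set Heisenberg} (hE : IsVerticalCurve m E)
    (h : l ≤ m) : IsVerticalCurve l E := by
  rw [isVerticalCurve_iff] at *
  exact fun p hp q hq => vCone_antitone h (hE p hp q hq)

theorem eq_of_mem_vCone {p q : Heisenberg} (h : p⁻¹ * q ∈ vCone 1) (hz : (p⁻¹ * q).z = 0) :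
    p = q := by
  have h' : 1 * ((p⁻¹ * q).x ^ 2 + (p⁻¹ * q).y ^ 2) ≤ |(p⁻¹ * q).z| := h
  rw [hz, abs_zero] at h'
  have hx : (p⁻¹ * q).x = 0 := by nlinarith [sq_nonneg (p⁻¹ * q).x, sq_nonneg (p⁻¹ * q).y]
  have hy : (p⁻¹ * q).y = 0 := by nlinarith [sq_nonneg (p⁻¹ * q).x, sq_nonneg (p⁻¹ * q).y]
  exact inv_mul_eq_one.1 (Heisenberg.ext hx hy hz)

/-- The symplectic term in the group law is controlled by the vertical coordinates. -/
theorem abs_symplectic_le {lam : ℝ} (hlam : 0 < lam) {g h : Heisenberg} (hg : g ∈ vCone lam)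
    (hh : h ∈ vCone lam) : 2 * lam * |g.x * h.y - h.x * g.y| ≤ |g.z| + |h.z| := by
  have hg' : lam * (g.x ^ 2 + g.y ^ 2) ≤ |g.z| := hg
  have hh' : lam * (h.x ^ 2 + h.y ^ 2) ≤ |h.z| := hh
  have h1 : 2 * |g.x * h.y - h.x * g.y| ≤ g.x ^ 2 + g.y ^ 2 + (h.x ^ 2 + h.y ^ 2) := by
    rcases abs_cases (g.x * h.y - h.x * g.y) with ⟨e, -⟩ | ⟨e, -⟩ <;> rw [e] <;>
      nlinarith [sq_nonneg (g.x - h.y), sq_nonneg (g.x + h.y), sq_nonneg (g.y - h.x),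
        sq_nonneg (g.y + h.x)]
  nlinarith

/-- On vertical cones the vertical coordinate is almost additive. -/
theorem half_add_le_mul_z {σ : ℝ} (hσ : |σ| = 1) {g h : Heisenberg} (hg : g ∈ vCone 1)
    (hh : h ∈ vCone 1) (hgz : 0 ≤ σ * g.z) (hhz : 0 ≤ σ * h.z) :
    (σ * g.z + σ * h.z) / 2 ≤ σ * (g * h).z := by
  have h1 := abs_symplectic_le one_pos hg hh
  have e1 : |g.z| = σ * g.z := by rw [← abs_of_nonneg hgz, abs_mul, hσ, one_mul]
  have e2 : |h.z| = σ * h.z := by rw [← abs_of_nonneg hhz, abs_mul, hσ, one_mul]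
  have e3 : -|g.x * h.y - h.x * g.y| ≤ σ * (g.x * h.y - h.x * g.y) := by
    rw [← one_mul |g.x * h.y - h.x * g.y|, ← hσ, ← abs_mul]
    exact neg_abs_le _
  rw [mul_z]
  nlinarith

theorem IsVerticalCurve.isCompact_setOf_abs_z_le {E : Set Heisenberg} (hE : IsVerticalCurve 1 E)
    {F : Set Heisenberg} (hF : IsClosed F) (hFE : F ⊆ E) {p : Heisenberg} (hp : p ∈ E) {M : ℝ}
    (hM : ∀ q ∈ F, |(p⁻¹ * q).z| ≤ M) : IsCompact F := by
  -- The cone bounds only the squares of the horizontal coordinates by `M`; the radius `M + 1` works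
  -- because `M ≤ (M + 1) ^ 2`.
  refine (isCompact_box p (M + 1)).of_isClosed_subset hF fun q hq => ?_
  have h : 1 * ((p⁻¹ * q).x ^ 2 + (p⁻¹ * q).y ^ 2) ≤ |(p⁻¹ * q).z| :=
    isVerticalCurve_iff.1 hE p hp q (hFE hq)
  have hz := hM q hq
  refine ⟨abs_le_of_sq_le_sq ?_ ?_, abs_le_of_sq_le_sq ?_ ?_, ?_⟩ <;>
    nlinarith [sq_nonneg (p⁻¹ * q).x, sq_nonneg (p⁻¹ * q).y, abs_nonneg (p⁻¹ * q).z]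

theorem continuous_inv_mul_z (p : Heisenberg) : Continuous fun q : Heisenberg => (p⁻¹ * q).z :=
  continuous_z.comp (continuous_const_mul _)

/-- A nonempty closed vertical curve which lies on one side of a further point has an extremal
point on that side. -/
theorem IsVerticalCurve.exists_extremal {σ : ℝ} (hσ : |σ| = 1) {E : Set Heisenberg}
    {p : Heisenberg} (hE : IsVerticalCurve 1 (insert p E)) (hcl : IsClosed E) (hne : E.Nonempty)
    (hp : ∀ e ∈ E, 0 < σ * (e⁻¹ * p).z) :
    ∃ m ∈ E, ∀ q ∈ E, q ≠ m → 0 < σ * (q⁻¹ * m).z := by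
  rw [isVerticalCurve_iff] at hE
  have hEE : IsVerticalCurve 1 E := (isVerticalCurve_iff.2 hE).mono (Set.subset_insert p E)
  have hσ0 : σ ≠ 0 := by rintro rfl; simp at hσ
  -- The part of `E` from `e` onwards, towards `p`. It is bounded because `p` lies beyond it; these
  -- sets are nested, and a common point is extremal.
  let K : E → Set Heisenberg := fun e => {q | q ∈ E ∧ 0 ≤ σ * ((e : Heisenberg)⁻¹ * q).z}
  have hKcl : ∀ e, IsClosed (K e) := fun e =>
    hcl.inter (isClosed_le continuous_const (continuous_const.mul (continuous_inv_mul_z _)))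
  have hKcpt : ∀ e, IsCompact (K e) := fun e => by
    refine hEE.isCompact_setOf_abs_z_le (hKcl e) (fun q hq => hq.1) e.2
      (M := 2 * (σ * ((e : Heisenberg)⁻¹ * p).z)) fun q hq => ?_
    have h := half_add_le_mul_z hσ (hE e (Or.inr e.2) q (Or.inr hq.1))
      (hE q (Or.inr hq.1) p (Or.inl rfl)) hq.2 (hp q hq.1).le
    rw [show (e : Heisenberg)⁻¹ * q * (q⁻¹ * p) = (e : Heisenberg)⁻¹ * p by group] at h
    rw [← one_mul |_|, ← hσ, ← abs_mul, abs_of_nonneg hq.2]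
    linarith [hp q hq.1]
  have hKne : ∀ e, (K e).Nonempty := fun e => ⟨e, e.2, by simp⟩
  have hKanti : ∀ e f : E, 0 ≤ σ * ((e : Heisenberg)⁻¹ * f).z → K f ⊆ K e := by
    intro e f hef q hq
    refine ⟨hq.1, ?_⟩
    have h := half_add_le_mul_z hσ (hE e (Or.inr e.2) f (Or.inr f.2))
      (hE f (Or.inr f.2) q (Or.inr hq.1)) hef hq.2
    rw [show (e : Heisenberg)⁻¹ * f * ((f : Heisenberg)⁻¹ * q) = (e : Heisenberg)⁻¹ * q by
      group] at h
    linarith [hq.2]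
  have hdir : Directed (· ⊇ ·) K := by
    intro e f
    rcases le_total 0 (σ * ((e : Heisenberg)⁻¹ * f).z) with h | h
    · exact ⟨f, hKanti e f h, subset_rfl⟩
    · refine ⟨e, subset_rfl, hKanti f e ?_⟩
      rw [inv_mul_z_comm]
      linarith
  have : Nonempty E := hne.to_subtype
  obtain ⟨m, hm⟩ := IsCompact.nonempty_iInter_of_directed_nonempty_isCompact_isClosed K hdir hKne
    hKcpt hKcl
  rw [Set.mem_iInter] at hm
  have hmE : m ∈ E := (hm (Classical.arbitrary E)).1
  refine ⟨m, hmE, fun q hq hqm => lt_of_le_of_ne (hm ⟨q, hq⟩).2 fun h0 => hqm ?_⟩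
  exact eq_of_mem_vCone (hE q (Or.inr hq) m (Or.inr hmE))
    ((mul_eq_zero.1 h0.symm).resolve_left hσ0)

/-- A nonempty closed connected vertical curve without endpoints is maximal among vertical
curves. -/
theorem IsVerticalCurve.eq_of_subset {E F : Set Heisenberg} (hF : IsVerticalCurve 1 F)
    (hEF : E ⊆ F) (hcl : IsClosed E) (hconn : IsConnected E) (hend : HasNoEndpoints E) :
    F = E := by
  refine (Set.Subset.antisymm hEF fun p hp => ?_).symm
  by_contra hpE
  have hE : IsVerticalCurve 1 (insert p E) := hF.mono (Set.insert_subset hp hEF)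
  have hF' := isVerticalCurve_iff.1 hF
  have hz : ∀ e ∈ E, (p⁻¹ * e).z ≠ 0 := fun e he h0 =>
    hpE (eq_of_mem_vCone (hF' p hp e (hEF he)) h0 ▸ he)
  by_cases hpos : ∀ e ∈ E, 0 < (p⁻¹ * e).z
  · obtain ⟨m, hm, hmin⟩ := hE.exists_extremal (σ := -1) (by simp) hcl hconn.nonempty
      fun e he => by rw [inv_mul_z_comm]; linarith [hpos e he]
    refine hend m ⟨hm, Or.inl fun q hq hqm => ?_⟩
    have := hmin q hq hqm
    rw [inv_mul_z_comm] at this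
    exact (by linarith : 0 < (m⁻¹ * q).z)
  by_cases hneg : ∀ e ∈ E, (p⁻¹ * e).z < 0
  · obtain ⟨m, hm, hmax⟩ := hE.exists_extremal (σ := 1) (by simp) hcl hconn.nonempty
      fun e he => by rw [inv_mul_z_comm]; linarith [hneg e he]
    refine hend m ⟨hm, Or.inr fun q hq hqm => ?_⟩
    exact (by linarith [hmax q hq hqm] : 0 < (q⁻¹ * m).z)
  -- Now `E` has points on both sides of `p`, so by connectedness it has one at relative height
  -- zero, which must be `p`.
  push Not at hpos hneg
  obtain ⟨e, he, hez⟩ := hpos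
  obtain ⟨f, hf, hfz⟩ := hneg
  obtain ⟨g, hg, hgz⟩ := hconn.isPreconnected.intermediate_value he hf
    (continuous_inv_mul_z p).continuousOn ⟨hez, hfz⟩
  exact hz g hg hgz

/-! ### Coordinates adapted to a vertical plane -/

/-- The coordinate in the direction `(a, b)` of the horizontal part. -/
def normalCoord (a b : ℝ) (p : Heisenberg) : ℝ := a * p.x + b * p.y

/-- The coordinate in the direction `(-b, a)` of the horizontal part. -/
def tangentCoord (a b : ℝ) (p : Heisenberg) : ℝ := a * p.y - b * p.x

/-- The horizontal one-parameter subgroup in the direction `(a, b)`. -/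
def horizontal (a b t : ℝ) : Heisenberg := ⟨t * a, t * b, 0⟩

/-- The fourth power of the Korányi norm. -/
def quarticNorm (p : Heisenberg) : ℝ := (p.x ^ 2 + p.y ^ 2) ^ 2 + 16 * p.z ^ 2

@[simp] theorem horizontal_x (a b t : ℝ) : (horizontal a b t).x = t * a := rfl
@[simp] theorem horizontal_y (a b t : ℝ) : (horizontal a b t).y = t * b := rfl
@[simp] theorem horizontal_z (a b t : ℝ) : (horizontal a b t).z = 0 := rfl

theorem horizontal_zero (a b : ℝ) : horizontal a b 0 = 1 := by ext <;> simp

theorem horizontal_add (a b s t : ℝ) :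
    horizontal a b (s + t) = horizontal a b s * horizontal a b t := by ext <;> simp <;> ring

theorem horizontal_neg (a b t : ℝ) : horizontal a b (-t) = (horizontal a b t)⁻¹ := by
  ext <;> simp

theorem continuous_horizontal (a b : ℝ) : Continuous (horizontal a b) :=
  continuous_mk (by fun_prop) (by fun_prop) continuous_const

theorem continuous_normalCoord (a b : ℝ) : Continuous (normalCoord a b) :=
  (continuous_const.mul continuous_x).add (continuous_const.mul continuous_y)

theorem continuous_tangentCoord (a b : ℝ) : Continuous (tangentCoord a b) :=
  (continuous_const.mul continuous_y).sub (continuous_const.mul continuous_x)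

theorem continuous_quarticNorm : Continuous quarticNorm :=
  (((continuous_x.pow 2).add (continuous_y.pow 2)).pow 2).add
    (continuous_const.mul (continuous_z.pow 2))

theorem normalCoord_mul (a b : ℝ) (p q : Heisenberg) :
    normalCoord a b (p * q) = normalCoord a b p + normalCoord a b q := by
  simp only [normalCoord, mul_x, mul_y]; ring

theorem tangentCoord_mul (a b : ℝ) (p q : Heisenberg) :
    tangentCoord a b (p * q) = tangentCoord a b p + tangentCoord a b q := by
  simp only [tangentCoord, mul_x, mul_y]; ring

theorem normalCoord_inv (a b : ℝ) (p : Heisenberg) :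
    normalCoord a b p⁻¹ = -normalCoord a b p := by
  simp only [normalCoord, inv_x, inv_y]; ring

theorem tangentCoord_inv (a b : ℝ) (p : Heisenberg) :
    tangentCoord a b p⁻¹ = -tangentCoord a b p := by
  simp only [tangentCoord, inv_x, inv_y]; ring

theorem tangentCoord_horizontal (a b t : ℝ) : tangentCoord a b (horizontal a b t) = 0 := by
  simp only [tangentCoord, horizontal_x, horizontal_y]; ring

section Unit

variable {a b : ℝ} (hab : a ^ 2 + b ^ 2 = 1)
include hab

theorem normalCoord_horizontal (t : ℝ) : normalCoord a b (horizontal a b t) = t := by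
  simp only [normalCoord, horizontal_x, horizontal_y]; linear_combination t * hab

theorem sq_add_sq_eq (p : Heisenberg) :
    p.x ^ 2 + p.y ^ 2 = normalCoord a b p ^ 2 + tangentCoord a b p ^ 2 := by
  simp only [normalCoord, tangentCoord]; linear_combination -(p.x ^ 2 + p.y ^ 2) * hab

theorem mul_z_eq (p q : Heisenberg) : (p * q).z = p.z + q.z + (1 / 2 : ℝ) *
    (normalCoord a b p * tangentCoord a b q - normalCoord a b q * tangentCoord a b p) := by
  simp only [normalCoord, tangentCoord, mul_z]
  linear_combination -(1 / 2 : ℝ) * (p.x * q.y - q.x * p.y) * hab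

theorem mul_horizontal_z (p : Heisenberg) (t : ℝ) :
    (p * horizontal a b t).z = p.z - t * tangentCoord a b p / 2 := by
  rw [mul_z_eq hab, normalCoord_horizontal hab, tangentCoord_horizontal, horizontal_z]
  ring

theorem normalCoord_pow_four_le (p : Heisenberg) : normalCoord a b p ^ 4 ≤ quarticNorm p := by
  rw [quarticNorm, sq_add_sq_eq hab]
  nlinarith [sq_nonneg (normalCoord a b p * tangentCoord a b p),
    sq_nonneg (tangentCoord a b p ^ 2), sq_nonneg p.z]

end Unit

theorem quarticNorm_nonneg (p : Heisenberg) : 0 ≤ quarticNorm p := by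
  unfold quarticNorm; positivity

theorem koranyiNorm_nonneg (p : Heisenberg) : 0 ≤ koranyiNorm p :=
  Real.rpow_nonneg (quarticNorm_nonneg p) _

theorem koranyiNorm_pow_four (p : Heisenberg) : koranyiNorm p ^ 4 = quarticNorm p := by
  change (quarticNorm p ^ (1 / 4 : ℝ)) ^ 4 = quarticNorm p
  rw [← Real.rpow_natCast, ← Real.rpow_mul (quarticNorm_nonneg p)]
  norm_num

theorem abs_normalCoord_le {a b : ℝ} (hab : a ^ 2 + b ^ 2 = 1) (p : Heisenberg) :
    |normalCoord a b p| ≤ koranyiNorm p := by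
  rw [← pow_le_pow_iff_left₀ (abs_nonneg _) (koranyiNorm_nonneg p) four_ne_zero,
    koranyiNorm_pow_four, Even.pow_abs (by decide)]
  exact normalCoord_pow_four_le hab p

/-! ### Vertical planes -/

/-- A vertical plane has a unit normal. -/
theorem IsVerticalPlane.exists_normal {W : Subgroup Heisenberg} (hW : IsVerticalPlane W) :
    ∃ a b : ℝ, a ^ 2 + b ^ 2 = 1 ∧ ∀ p, p ∈ W ↔ normalCoord a b p = 0 := by
  obtain ⟨⟨S, hS, hSW⟩, hZ⟩ := hW
  have hmem : ∀ p, p ∈ W ↔ coords p ∈ S := fun p => by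
    rw [← SetLike.mem_coe (p := S), ← hSW, coords.injective.mem_set_image, SetLike.mem_coe]
  have hlt : S < ⊤ := by
    refine lt_top_iff_ne_top.2 fun h => ?_
    rw [h, finrank_top] at hS
    simp at hS
  -- The plane is the kernel of a functional, which does not see `z` because the plane contains the
  -- center; its other two coefficients give the normal.
  obtain ⟨f, hf, hSf⟩ := S.exists_le_ker_of_lt_top hlt
  have hker : S = LinearMap.ker f := by
    refine Submodule.eq_of_le_of_finrank_eq hSf ?_
    have h := Module.Dual.finrank_ker_add_one_of_ne_zero hf
    have h3 : Module.finrank ℝ (ℝ × ℝ × ℝ) = 3 := by simp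
    omega
  have h3 : f (0, 0, 1) = 0 := by
    have h := (hmem ⟨0, 0, 1⟩).1 (hZ 1)
    rw [hker] at h
    exact h
  have hfp : ∀ x y z : ℝ, f (x, y, z) = f (1, 0, 0) * x + f (0, 1, 0) * y := fun x y z => by
    have : ((x, y, z) : ℝ × ℝ × ℝ) = x • (1, 0, 0) + y • (0, 1, 0) + z • (0, 0, 1) := by simp
    rw [this, map_add, map_add, map_smul, map_smul, map_smul, h3]
    simp only [smul_eq_mul]; ring
  set α := f (1, 0, 0)
  set β := f (0, 1, 0)
  have hpos : 0 < α ^ 2 + β ^ 2 := by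
    by_contra h
    have hα : α = 0 := by nlinarith [sq_nonneg α, sq_nonneg β]
    have hβ : β = 0 := by nlinarith [sq_nonneg α, sq_nonneg β]
    refine hf (LinearMap.ext fun v => ?_)
    obtain ⟨x, y, z⟩ := v
    rw [hfp, hα, hβ]
    simp
  have hr : 0 < √(α ^ 2 + β ^ 2) := Real.sqrt_pos.2 hpos
  refine ⟨α / √(α ^ 2 + β ^ 2), β / √(α ^ 2 + β ^ 2), ?_, fun p => ?_⟩
  · rw [div_pow, div_pow, Real.sq_sqrt hpos.le, ← add_div, div_self hpos.ne']
  · rw [hmem, hker]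
    change f (p.x, p.y, p.z) = 0 ↔ _
    rw [hfp, normalCoord, div_mul_eq_mul_div, div_mul_eq_mul_div, ← add_div, div_eq_zero_iff]
    simp [hr.ne']

section Plane

variable {W : Subgroup Heisenberg} {a b : ℝ} (hab : a ^ 2 + b ^ 2 = 1)
  (hW : ∀ p, p ∈ W ↔ normalCoord a b p = 0)
include hab hW

/-- Following the normal line from `p` to `W` attains this value. No point of `W` is closer, since
left translation by `W` preserves the normal coordinate and the norm dominates it. -/
theorem koranyiDistTo_eq (p : Heisenberg) : koranyiDistTo p W = |normalCoord a b p| := by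
  refine le_antisymm ?_ (le_ciInf fun w => ?_)
  · have hw : p * horizontal a b (-normalCoord a b p) ∈ W := by
      rw [hW, normalCoord_mul, normalCoord_horizontal hab, add_neg_cancel]
    refine (ciInf_le ⟨0, ?_⟩ ⟨_, hw⟩).trans ?_
    · rintro _ ⟨w, rfl⟩
      exact koranyiNorm_nonneg _
    · change koranyiNorm ((p * horizontal a b (-normalCoord a b p))⁻¹ * p) ≤ |normalCoord a b p|
      rw [← pow_le_pow_iff_left₀ (koranyiNorm_nonneg _) (abs_nonneg _) four_ne_zero,
        koranyiNorm_pow_four, Even.pow_abs (by decide), mul_inv_rev, inv_mul_cancel_right, ← horizontal_neg, neg_neg, quarticNorm,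
        sq_add_sq_eq hab, normalCoord_horizontal hab, tangentCoord_horizontal, horizontal_z]
      apply le_of_eq
      ring
  · refine (abs_normalCoord_le hab ((w : Heisenberg)⁻¹ * p)).trans' (le_of_eq ?_)
    rw [normalCoord_mul, normalCoord_inv, (hW w).1 w.2, neg_zero, zero_add]

theorem mem_cone_iff {L : ℝ} (hL : 0 ≤ L) (p : Heisenberg) :
    p ∈ cone W L ↔ normalCoord a b p ^ 4 ≤ L ^ 4 * quarticNorm p := by
  have h1 : quarticNorm (p⁻¹ * 1) = quarticNorm p := by simp [quarticNorm]
  change koranyiDistTo p W ≤ L * koranyiDist 1 p ↔ _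
  rw [koranyiDistTo_eq hab hW, koranyiDist, ← pow_le_pow_iff_left₀ (abs_nonneg _)
    (mul_nonneg hL (koranyiNorm_nonneg _)) four_ne_zero, mul_pow, koranyiNorm_pow_four, h1,
    Even.pow_abs (by decide)]

theorem mem_horizontalPerp_iff (v : Heisenberg) :
    v ∈ horizontalPerp W ↔ v = horizontal a b (normalCoord a b v) := by
  constructor
  · rintro ⟨hz, hv⟩
    have h := hv ⟨-b, a, 0⟩ (by rw [hW, normalCoord]; ring)
    dsimp only at h
    ext
    · simp only [horizontal_x, normalCoord]; linear_combination -v.x * hab + -b * h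
    · simp only [horizontal_y, normalCoord]; linear_combination -v.y * hab + a * h
    · exact hz
  · intro h
    rw [h]
    refine ⟨rfl, fun w hw => ?_⟩
    rw [hW, normalCoord] at hw
    rw [horizontal_x, horizontal_y]
    linear_combination normalCoord a b v * hw

/-- Every coset of the normal line crosses `W`, so surjectivity of the projection can be tested from
an arbitrary base point. -/
theorem isEntireILipGraph_iff {L : ℝ} (hL : 0 ≤ L) {Γ : Set Heisenberg} :
    IsEntireILipGraph W L Γ ↔
      (∀ p ∈ Γ, ∀ q ∈ Γ, normalCoord a b (p⁻¹ * q) ^ 4 ≤ L ^ 4 * quarticNorm (p⁻¹ * q)) ∧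
        ∀ p, ∃ t, p * horizontal a b t ∈ Γ := by
  simp only [IsEntireILipGraph, IsILipGraph, Set.subset_def, Set.mem_smul_set_iff_inv_smul_mem,
    smul_eq_mul, mem_cone_iff hab hW hL]
  refine and_congr_right fun _ => ⟨fun h p => ?_, fun h => ?_⟩
  · have hw : p * horizontal a b (-normalCoord a b p) ∈ (W : Set Heisenberg) := by
      rw [SetLike.mem_coe, hW, normalCoord_mul, normalCoord_horizontal hab, add_neg_cancel]
    rw [← h] at hw
    obtain ⟨-, v, hv, hmem⟩ := hw
    rw [mem_horizontalPerp_iff hab hW] at hv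
    rw [hv, mul_assoc, ← horizontal_add] at hmem
    exact ⟨_, hmem⟩
  · refine Set.Subset.antisymm (fun w hw => hw.1) fun w hw => ⟨hw, ?_⟩
    obtain ⟨t, ht⟩ := h w
    refine ⟨horizontal a b t, ?_, ht⟩
    rw [mem_horizontalPerp_iff hab hW, normalCoord_horizontal hab]

end Plane

/-- The determinant of the unit normals of two distinct vertical planes does not vanish. -/
theorem det_normals_ne_zero {W₁ W₂ : Subgroup Heisenberg} (hne : W₁ ≠ W₂) {a₁ b₁ a₂ b₂ : ℝ}
    (h₁ : a₁ ^ 2 + b₁ ^ 2 = 1) (h₂ : a₂ ^ 2 + b₂ ^ 2 = 1)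
    (hW₁ : ∀ p, p ∈ W₁ ↔ normalCoord a₁ b₁ p = 0) (hW₂ : ∀ p, p ∈ W₂ ↔ normalCoord a₂ b₂ p = 0) :
    a₁ * b₂ - a₂ * b₁ ≠ 0 := by
  intro hD
  refine hne (SetLike.ext fun p => ?_)
  rw [hW₁, hW₂]
  simp only [normalCoord]
  constructor <;> intro h
  · linear_combination (a₁ * a₂ + b₁ * b₂) * h + (a₁ * p.y - b₁ * p.x) * hD -
      (a₂ * p.x + b₂ * p.y) * h₁
  · linear_combination (a₁ * a₂ + b₁ * b₂) * h - (a₂ * p.y - b₂ * p.x) * hD -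
      (a₁ * p.x + b₁ * p.y) * h₂

/-- Cramer's rule gives `e3`; adding the sum of squares `e4` cancels the cross term. This is the
quantitative transversality of the planes. -/
theorem sq_add_sq_mul_det_sq_le {a₁ b₁ a₂ b₂ : ℝ} (h₁ : a₁ ^ 2 + b₁ ^ 2 = 1)
    (h₂ : a₂ ^ 2 + b₂ ^ 2 = 1) (p : Heisenberg) :
    (a₁ * b₂ - a₂ * b₁) ^ 2 * (p.x ^ 2 + p.y ^ 2) ≤
      2 * (normalCoord a₁ b₁ p ^ 2 + normalCoord a₂ b₂ p ^ 2) := by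
  have e1 : (a₁ * b₂ - a₂ * b₁) * p.x = normalCoord a₁ b₁ p * b₂ - normalCoord a₂ b₂ p * b₁ := by
    simp only [normalCoord]; ring
  have e2 : (a₁ * b₂ - a₂ * b₁) * p.y = normalCoord a₂ b₂ p * a₁ - normalCoord a₁ b₁ p * a₂ := by
    simp only [normalCoord]; ring
  set m := normalCoord a₁ b₁ p
  set n := normalCoord a₂ b₂ p
  have e3 : (a₁ * b₂ - a₂ * b₁) ^ 2 * (p.x ^ 2 + p.y ^ 2) =
      m ^ 2 + n ^ 2 - 2 * m * n * (a₁ * a₂ + b₁ * b₂) := by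
    rw [mul_add, ← mul_pow, ← mul_pow, e1, e2]
    linear_combination m ^ 2 * h₂ + n ^ 2 * h₁
  have e4 : (m * a₁ + n * a₂) ^ 2 + (m * b₁ + n * b₂) ^ 2 =
      m ^ 2 + n ^ 2 + 2 * m * n * (a₁ * a₂ + b₁ * b₂) := by
    linear_combination m ^ 2 * h₁ + n ^ 2 * h₂
  nlinarith [sq_nonneg (m * a₁ + n * a₂), sq_nonneg (m * b₁ + n * b₂)]

theorem det_sq_le_one {a₁ b₁ a₂ b₂ : ℝ} (h₁ : a₁ ^ 2 + b₁ ^ 2 = 1) (h₂ : a₂ ^ 2 + b₂ ^ 2 = 1) :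
    (a₁ * b₂ - a₂ * b₁) ^ 2 ≤ 1 := by
  have : (a₁ * b₂ - a₂ * b₁) ^ 2 = 1 - (a₁ * a₂ + b₁ * b₂) ^ 2 := by
    linear_combination (a₂ ^ 2 + b₂ ^ 2) * h₁ + h₂
  linarith [sq_nonneg (a₁ * a₂ + b₁ * b₂)]

/-! ### Intrinsic Lipschitz graphs as boundaries of unions of cones -/

/-- An open homogeneous cone around the horizontal direction `(a, b)` which is a semigroup. -/
def openCone (a b κ : ℝ) : Set Heisenberg :=
  {g | 0 < normalCoord a b g ∧
    tangentCoord a b g ^ 2 + 4 * κ * |g.z| < κ ^ 2 * normalCoord a b g ^ 2}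

/-- The boundary of `E * openCone a b κ`, described along the lines in the direction `(a, b)`. -/
def coneGraph (a b κ : ℝ) (E : Set Heisenberg) : Set Heisenberg :=
  {p | ∀ ε : ℝ, 0 < ε → (∃ e ∈ E, e⁻¹ * (p * horizontal a b ε) ∈ openCone a b κ) ∧
    ∀ e ∈ E, e⁻¹ * (p * horizontal a b (-ε)) ∉ openCone a b κ}

theorem isOpen_openCone (a b κ : ℝ) : IsOpen (openCone a b κ) :=
  (isOpen_lt continuous_const (continuous_normalCoord a b)).inter
    (isOpen_lt (((continuous_tangentCoord a b).pow 2).add (continuous_const.mul continuous_z.abs))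
      (continuous_const.mul ((continuous_normalCoord a b).pow 2)))

section Cone

variable {a b κ : ℝ} (hab : a ^ 2 + b ^ 2 = 1) (hκ : 0 < κ)
include hab hκ

/-- Both factors satisfy `|m| < κ n`, and the products `(κ n ± m) (κ n' ∓ m')` are nonnegative.
Hence the symplectic contribution to `z` is paid for exactly by the cross terms of the squares. -/
theorem mul_mem_openCone {g h : Heisenberg} (hg : g ∈ openCone a b κ) (hh : h ∈ openCone a b κ) :
    g * h ∈ openCone a b κ := by
  obtain ⟨hn, hgc⟩ := hg
  obtain ⟨hn', hhc⟩ := hh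
  refine ⟨by rw [normalCoord_mul]; linarith, ?_⟩
  rw [mul_z_eq hab, normalCoord_mul, tangentCoord_mul]
  set n := normalCoord a b g
  set n' := normalCoord a b h
  set m := tangentCoord a b g
  set m' := tangentCoord a b h
  have hm := abs_lt.1 (abs_lt_of_sq_lt_sq (a := m) (b := κ * n)
    (by nlinarith [mul_nonneg hκ.le (abs_nonneg g.z)]) (by positivity))
  have hm' := abs_lt.1 (abs_lt_of_sq_lt_sq (a := m') (b := κ * n')
    (by nlinarith [mul_nonneg hκ.le (abs_nonneg h.z)]) (by positivity))
  have h1 : κ * |n * m' - n' * m| ≤ κ ^ 2 * (n * n') - m * m' := by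
    rcases abs_cases (n * m' - n' * m) with ⟨e, -⟩ | ⟨e, -⟩ <;> rw [e]
    · nlinarith [mul_nonneg (by linarith : 0 ≤ κ * n + m) (by linarith : 0 ≤ κ * n' - m')]
    · nlinarith [mul_nonneg (by linarith : 0 ≤ κ * n - m) (by linarith : 0 ≤ κ * n' + m')]
  have h2 : |g.z + h.z + 1 / 2 * (n * m' - n' * m)| ≤
      |g.z| + |h.z| + 1 / 2 * |n * m' - n' * m| := by
    refine (abs_add_le _ _).trans (add_le_add (abs_add_le _ _) ?_)
    rw [abs_mul, abs_of_pos (by norm_num : (0 : ℝ) < 1 / 2)]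
  nlinarith [mul_le_mul_of_nonneg_left h2 hκ.le]

theorem horizontal_mem_openCone {t : ℝ} (ht : 0 < t) : horizontal a b t ∈ openCone a b κ := by
  refine ⟨by rwa [normalCoord_horizontal hab], ?_⟩
  rw [tangentCoord_horizontal, normalCoord_horizontal hab, horizontal_z, abs_zero]
  simp only [ne_eq, OfNat.ofNat_ne_zero, not_false_eq_true, zero_pow, mul_zero, add_zero]
  positivity

omit hab in
-- The right side is quadratic in `t`, the left only of linear growth. In the proof `s` stands for
-- `n + t`.
theorem exists_lt_sq_mul (n m z : ℝ) :
    ∃ t, 0 < n + t ∧ m ^ 2 + 4 * κ * |z - t * m / 2| < κ ^ 2 * (n + t) ^ 2 := by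
  set A := |z + n * m / 2|
  set Q := m ^ 2 + 4 * κ * A + 2 * κ * |m|
  have hQ : 0 ≤ Q := by positivity
  set s := 1 + Q / κ ^ 2 with hs
  have hs1 : 1 ≤ s := le_add_of_nonneg_right (by positivity)
  have hsQ : κ ^ 2 * s = κ ^ 2 + Q := by rw [hs]; field_simp
  refine ⟨s - n, by linarith, ?_⟩
  have h1 : |z - (s - n) * m / 2| ≤ A + s * |m| / 2 := by
    rw [show z - (s - n) * m / 2 = z + n * m / 2 - s * m / 2 by ring]
    refine (abs_sub _ _).trans (le_of_eq ?_)
    rw [abs_div, abs_mul, abs_of_pos (by linarith : 0 < s), abs_two]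
  have h2 : m ^ 2 + 4 * κ * (A + s * |m| / 2) ≤ s * Q := by
    nlinarith [mul_nonneg (sub_nonneg.2 hs1) (sq_nonneg m),
      mul_nonneg (sub_nonneg.2 hs1) (mul_nonneg hκ.le (abs_nonneg (z + n * m / 2)))]
  have h3 : κ ^ 2 * (n + (s - n)) ^ 2 = s * Q + κ ^ 2 * s := by
    linear_combination s * hsQ
  rw [h3]
  have := mul_le_mul_of_nonneg_left h1 (by positivity : 0 ≤ 4 * κ)
  nlinarith [sq_pos_of_pos hκ]

theorem exists_mul_horizontal_mem_openCone (g : Heisenberg) :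
    ∃ t, g * horizontal a b t ∈ openCone a b κ := by
  obtain ⟨t, h1, h2⟩ := exists_lt_sq_mul hκ (normalCoord a b g) (tangentCoord a b g) g.z
  refine ⟨t, ?_, ?_⟩
  · rwa [normalCoord_mul, normalCoord_horizontal hab]
  · rwa [normalCoord_mul, tangentCoord_mul, normalCoord_horizontal hab, tangentCoord_horizontal,
      mul_horizontal_z hab, add_zero]

theorem exists_horizontal_mul_mem_openCone (g : Heisenberg) :
    ∃ t, horizontal a b t * g ∈ openCone a b κ := by
  obtain ⟨t, h1, h2⟩ := exists_lt_sq_mul hκ (normalCoord a b g) (tangentCoord a b g) (-g.z)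
  refine ⟨t, ?_, ?_⟩
  · rwa [normalCoord_mul, normalCoord_horizontal hab, add_comm]
  · rw [normalCoord_mul, tangentCoord_mul, normalCoord_horizontal hab, tangentCoord_horizontal,
      mul_z_eq hab, normalCoord_horizontal hab, tangentCoord_horizontal, horizontal_z, zero_add,
      add_comm t, ← abs_neg]
    convert h2 using 4
    ring

omit hκ in
theorem notMem_openCone_of_mem_vCone {lam : ℝ} (hκ : 0 ≤ κ) (hlam : κ ≤ 4 * lam)
    {g : Heisenberg} (hg : g ∈ vCone lam) : g ∉ openCone a b κ := by
  rintro ⟨-, h⟩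
  have hg' : lam * (g.x ^ 2 + g.y ^ 2) ≤ |g.z| := hg
  rw [sq_add_sq_eq hab] at hg'
  have h1 : κ * (normalCoord a b g ^ 2 + tangentCoord a b g ^ 2) ≤ 4 * |g.z| := by
    nlinarith [sq_nonneg (normalCoord a b g), sq_nonneg (tangentCoord a b g)]
  nlinarith [mul_le_mul_of_nonneg_left h1 hκ, sq_nonneg (tangentCoord a b g),
    mul_nonneg (sq_nonneg κ) (sq_nonneg (tangentCoord a b g))]

omit hab hκ in
theorem sq_mul_le_of_notMem_openCone (hκ : 0 ≤ κ) {g : Heisenberg} (hg : g ∉ openCone a b κ)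
    (hg' : g⁻¹ ∉ openCone a b κ) :
    κ ^ 2 * normalCoord a b g ^ 2 ≤ tangentCoord a b g ^ 2 + 4 * κ * |g.z| := by
  by_contra! h
  rcases lt_trichotomy (normalCoord a b g) 0 with h0 | h0 | h0
  · refine hg' ⟨by rw [normalCoord_inv]; linarith, ?_⟩
    rwa [normalCoord_inv, tangentCoord_inv, inv_z, abs_neg, neg_sq, neg_sq]
  · rw [h0] at h
    nlinarith [sq_nonneg (tangentCoord a b g), mul_nonneg hκ (abs_nonneg g.z)]
  · exact hg ⟨h0, h⟩

section Graph

variable {E : Set Heisenberg} (hE : ∀ p ∈ E, ∀ q ∈ E, p⁻¹ * q ∉ openCone a b κ)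

/-- If `q` were in `p * C`, openness would leave room to push `p` slightly forward and `q` slightly
back. The pushed `p` lies in `E * C`, so by the semigroup property the pulled-back `q` would too. -/
theorem notMem_openCone_of_mem_coneGraph {p q : Heisenberg} (hp : p ∈ coneGraph a b κ E)
    (hq : q ∈ coneGraph a b κ E) : p⁻¹ * q ∉ openCone a b κ := by
  intro h
  have hcont : Continuous fun ε : ℝ => horizontal a b (-ε) * (p⁻¹ * q) * horizontal a b (-ε) :=
    (((continuous_horizontal a b).comp continuous_neg).mul continuous_const).mul
      ((continuous_horizontal a b).comp continuous_neg)
  have hev : ∀ᶠ ε in 𝓝 (0 : ℝ),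
      horizontal a b (-ε) * (p⁻¹ * q) * horizontal a b (-ε) ∈ openCone a b κ :=
    hcont.continuousAt.eventually_mem
      ((isOpen_openCone a b κ).mem_nhds (by simpa [horizontal_zero] using h))
  obtain ⟨ε, hmem, hε⟩ :=
    ((hev.filter_mono nhdsWithin_le_nhds).and (self_mem_nhdsWithin (s := Set.Ioi 0))).exists
  obtain ⟨e, he, hep⟩ := (hp ε hε).1
  refine (hq ε hε).2 e he ?_
  convert mul_mem_openCone hab hκ hep hmem using 1
  rw [horizontal_neg]
  group

include hE

theorem subset_coneGraph : E ⊆ coneGraph a b κ E := by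
  refine fun e he ε hε => ⟨⟨e, he, ?_⟩, fun f hf hmem => hE f hf e he ?_⟩
  · rw [inv_mul_cancel_left]
    exact horizontal_mem_openCone hab hκ hε
  · convert mul_mem_openCone hab hκ hmem (horizontal_mem_openCone hab hκ hε) using 1
    rw [horizontal_neg]
    group

theorem exists_mul_horizontal_mem_coneGraph (hne : E.Nonempty) (p : Heisenberg) :
    ∃ t, p * horizontal a b t ∈ coneGraph a b κ E := by
  obtain ⟨e, he⟩ := hne
  -- The times at which the line through `p` is inside `E * C` form an upper ray; the boundary point
  -- is its infimum.
  let S : Set ℝ := {t | ∃ e ∈ E, e⁻¹ * (p * horizontal a b t) ∈ openCone a b κ}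
  have hup : ∀ s ∈ S, ∀ t, s < t → t ∈ S := by
    rintro s ⟨f, hf, hs⟩ t hst
    refine ⟨f, hf, ?_⟩
    convert mul_mem_openCone hab hκ hs (horizontal_mem_openCone hab hκ (sub_pos.2 hst)) using 1
    rw [mul_assoc, mul_assoc, ← horizontal_add, add_sub_cancel]
  have hSne : S.Nonempty := by
    obtain ⟨t, ht⟩ := exists_mul_horizontal_mem_openCone hab hκ (e⁻¹ * p)
    exact ⟨t, e, he, by rwa [mul_assoc] at ht⟩
  have hSbdd : BddBelow S := by
    -- Far enough back on the line, `e` itself lies in the forward cone, so entering `f * C` there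
    -- would give `e ∈ f * C`.
    obtain ⟨t, ht⟩ := exists_horizontal_mul_mem_openCone hab hκ (p⁻¹ * e)
    refine ⟨-t, fun s hs => not_lt.1 fun hst => ?_⟩
    obtain ⟨f, hf, hmem⟩ := hup s hs _ hst
    refine hE f hf e he ?_
    convert mul_mem_openCone hab hκ hmem ht using 1
    rw [horizontal_neg]
    group
  refine ⟨sInf S, fun ε hε => ⟨?_, fun f hf hmem => ?_⟩⟩
  · obtain ⟨s, hs, hlt⟩ := exists_lt_of_csInf_lt hSne (lt_add_of_pos_right (sInf S) hε)
    rw [mul_assoc, ← horizontal_add]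
    exact hup s hs _ hlt
  · rw [mul_assoc, ← horizontal_add] at hmem
    have : sInf S ≤ sInf S + -ε := csInf_le hSbdd ⟨f, hf, hmem⟩
    linarith

/-- Squaring `κ² n² ≤ m² + 4 κ |z|` with Cauchy–Schwarz gives `κ⁴ n⁴ ≤ (1 + κ²) (m⁴ + 16 z²)`;
adding `(1 + κ²) n⁴` to both sides produces the constant. -/
theorem isEntireILipGraph_coneGraph {W : Subgroup Heisenberg}
    (hW : ∀ p, p ∈ W ↔ normalCoord a b p = 0) (hne : E.Nonempty) :
    IsEntireILipGraph W (√√((1 + κ ^ 2) / (1 + κ ^ 2 + κ ^ 4))) (coneGraph a b κ E) := by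
  rw [isEntireILipGraph_iff hab hW (Real.sqrt_nonneg _)]
  refine ⟨fun p hp q hq => ?_, exists_mul_horizontal_mem_coneGraph hab hκ hE hne⟩
  have h := sq_mul_le_of_notMem_openCone hκ.le (notMem_openCone_of_mem_coneGraph hab hκ hp hq)
    (by rw [mul_inv_rev, inv_inv]; exact notMem_openCone_of_mem_coneGraph hab hκ hq hp)
  set g := p⁻¹ * q
  have hL : √√((1 + κ ^ 2) / (1 + κ ^ 2 + κ ^ 4)) ^ 4 = (1 + κ ^ 2) / (1 + κ ^ 2 + κ ^ 4) := by
    rw [show ∀ x : ℝ, x ^ 4 = (x ^ 2) ^ 2 from fun x => by ring, Real.sq_sqrt (Real.sqrt_nonneg _),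
      Real.sq_sqrt (by positivity)]
  rw [hL, div_mul_eq_mul_div, le_div_iff₀ (by positivity), quarticNorm, sq_add_sq_eq hab]
  set n := normalCoord a b g
  set m := tangentCoord a b g
  have h1 : (κ ^ 2 * n ^ 2) ^ 2 ≤ (m ^ 2 + 4 * κ * |g.z|) ^ 2 :=
    pow_le_pow_left₀ (by positivity) h 2
  have h2 : (m ^ 2 + 4 * κ * |g.z|) ^ 2 ≤ (1 + κ ^ 2) * (m ^ 4 + 16 * g.z ^ 2) := by
    rw [← sq_abs g.z]
    nlinarith [sq_nonneg (κ * m ^ 2 - 4 * |g.z|)]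
  nlinarith [mul_nonneg (by positivity : 0 ≤ 1 + κ ^ 2) (sq_nonneg (n * m))]

end Graph

end Cone

/-- Every sufficiently steep vertical curve is contained in the intersection of two entire
intrinsic Lipschitz graphs, which is again a vertical curve. -/
theorem exists_entire_graphs_inter {W₁ W₂ : Subgroup Heisenberg} {a₁ b₁ a₂ b₂ : ℝ}
    (h₁ : a₁ ^ 2 + b₁ ^ 2 = 1) (h₂ : a₂ ^ 2 + b₂ ^ 2 = 1)
    (hW₁ : ∀ p, p ∈ W₁ ↔ normalCoord a₁ b₁ p = 0) (hW₂ : ∀ p, p ∈ W₂ ↔ normalCoord a₂ b₂ p = 0)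
    (hD : a₁ * b₂ - a₂ * b₁ ≠ 0) :
    ∃ L : ℝ, 0 < L ∧ L < 1 ∧ ∀ lam : ℝ, 5 / (a₁ * b₂ - a₂ * b₁) ^ 2 ≤ lam →
      ∀ E : Set Heisenberg, IsVerticalCurve lam E → E.Nonempty → ∃ Γ₁ Γ₂ : Set Heisenberg,
        IsEntireILipGraph W₁ L Γ₁ ∧ IsEntireILipGraph W₂ L Γ₂ ∧
          IsVerticalCurve 1 (Γ₁ ∩ Γ₂) ∧ E ⊆ Γ₁ ∩ Γ₂ := by
  set d := (a₁ * b₂ - a₂ * b₁) ^ 2 with hd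
  have hd0 : 0 < d := by positivity
  have hd1 : d ≤ 1 := det_sq_le_one h₁ h₂
  -- With this choice `κ ≤ 4 * lam` is exactly the lower bound on `lam`, and the sum of the two cone
  -- inequalities beats the tangential terms in `e₄`.
  set κ := 20 / d with hκdef
  have hκ : 0 < κ := by positivity
  have hκd : κ * d = 20 := by rw [hκdef]; field_simp
  refine ⟨√√((1 + κ ^ 2) / (1 + κ ^ 2 + κ ^ 4)), by positivity, ?_, fun lam hlam E hE hne => ?_⟩
  · rw [Real.sqrt_lt' one_pos, Real.sqrt_lt' (by norm_num), div_lt_iff₀ (by positivity)]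
    have : 0 < κ ^ 4 := by positivity
    linarith
  have hκlam : κ ≤ 4 * lam := by
    rw [hκdef, show 20 / d = 4 * (5 / d) by ring]
    linarith
  rw [isVerticalCurve_iff] at hE
  have hE₁ : ∀ p ∈ E, ∀ q ∈ E, p⁻¹ * q ∉ openCone a₁ b₁ κ := fun p hp q hq =>
    notMem_openCone_of_mem_vCone h₁ hκ.le hκlam (hE p hp q hq)
  have hE₂ : ∀ p ∈ E, ∀ q ∈ E, p⁻¹ * q ∉ openCone a₂ b₂ κ := fun p hp q hq =>
    notMem_openCone_of_mem_vCone h₂ hκ.le hκlam (hE p hp q hq)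
  refine ⟨coneGraph a₁ b₁ κ E, coneGraph a₂ b₂ κ E,
    isEntireILipGraph_coneGraph h₁ hκ hE₁ hW₁ hne, isEntireILipGraph_coneGraph h₂ hκ hE₂ hW₂ hne,
    isVerticalCurve_iff.2 fun p hp q hq => ?_,
    Set.subset_inter (subset_coneGraph h₁ hκ hE₁) (subset_coneGraph h₂ hκ hE₂)⟩
  have g₁ := sq_mul_le_of_notMem_openCone hκ.le
    (notMem_openCone_of_mem_coneGraph h₁ hκ hp.1 hq.1)
    (by rw [mul_inv_rev, inv_inv]; exact notMem_openCone_of_mem_coneGraph h₁ hκ hq.1 hp.1)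
  have g₂ := sq_mul_le_of_notMem_openCone hκ.le
    (notMem_openCone_of_mem_coneGraph h₂ hκ hp.2 hq.2)
    (by rw [mul_inv_rev, inv_inv]; exact notMem_openCone_of_mem_coneGraph h₂ hκ hq.2 hp.2)
  set g := p⁻¹ * q
  change 1 * (g.x ^ 2 + g.y ^ 2) ≤ |g.z|
  have e₁ := sq_add_sq_eq h₁ g
  have e₂ := sq_add_sq_eq h₂ g
  have e₃ := sq_add_sq_mul_det_sq_le h₁ h₂ g
  rw [← hd] at e₃
  set r := g.x ^ 2 + g.y ^ 2
  have hr : 0 ≤ r := by positivity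
  have e₄ : κ * (10 * r) ≤ 2 * r + 8 * κ * |g.z| := by
    have h := mul_le_mul_of_nonneg_left e₃ (sq_nonneg κ)
    rw [show κ ^ 2 * (d * r) = 20 * (κ * r) by linear_combination κ * r * hκd] at h
    linarith [sq_nonneg (normalCoord a₁ b₁ g), sq_nonneg (normalCoord a₂ b₂ g)]
  have hκ20 : 20 ≤ κ := by nlinarith
  by_contra! hlt
  nlinarith [mul_le_mul_of_nonneg_right hκ20 hr, mul_lt_mul_of_pos_left hlt hκ]

/-! ### Intersections of entire intrinsic Lipschitz graphs with small constant -/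

/-- Entire intrinsic Lipschitz graphs over the plane with unit normal `(a, b)`, in coordinates. -/
structure IsEntireGraph (a b L : ℝ) (Γ : Set Heisenberg) : Prop where
  pow_four_le : ∀ p ∈ Γ, ∀ q ∈ Γ,
    normalCoord a b (p⁻¹ * q) ^ 4 ≤ L ^ 4 * quarticNorm (p⁻¹ * q)
  exists_mem : ∀ p, ∃ t, p * horizontal a b t ∈ Γ

namespace IsEntireGraph

variable {a b L : ℝ} {Γ : Set Heisenberg}

/-- A limit point `p` satisfies the cone inequality against the graph point on its own normal line.
That displacement is purely normal, so `t ^ 4 ≤ L ^ 4 * t ^ 4` forces `t = 0`. -/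
theorem isClosed (h : IsEntireGraph a b L Γ) (hab : a ^ 2 + b ^ 2 = 1) (hL : L ^ 4 < 1) :
    IsClosed Γ := by
  refine isClosed_of_closure_subset fun p hp => ?_
  obtain ⟨t, ht⟩ := h.exists_mem p
  have hcl : IsClosed {q : Heisenberg |
      normalCoord a b ((p * horizontal a b t)⁻¹ * q) ^ 4 ≤
        L ^ 4 * quarticNorm ((p * horizontal a b t)⁻¹ * q)} :=
    isClosed_le (((continuous_normalCoord a b).comp (continuous_const_mul _)).pow 4)
      (continuous_const.mul (continuous_quarticNorm.comp (continuous_const_mul _)))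
  have hp' : normalCoord a b ((p * horizontal a b t)⁻¹ * p) ^ 4 ≤
      L ^ 4 * quarticNorm ((p * horizontal a b t)⁻¹ * p) :=
    closure_minimal (h.pow_four_le _ ht) hcl hp
  rw [mul_inv_rev, inv_mul_cancel_right, ← horizontal_neg, quarticNorm,
    sq_add_sq_eq hab, normalCoord_horizontal hab, tangentCoord_horizontal, horizontal_z] at hp'
  have ht0 : t ^ 4 = 0 := by
    have : 0 ≤ t ^ 4 := by positivity
    nlinarith
  rwa [pow_eq_zero_iff four_ne_zero |>.1 ht0, horizontal_zero, mul_one] at ht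

/-- Moving from a point of the graph tangentially to the plane changes the graph little. -/
theorem pow_four_le_of_normalCoord_eq_zero (h : IsEntireGraph a b L Γ) (hab : a ^ 2 + b ^ 2 = 1)
    (hL : 12 * L ^ 4 ≤ 1) {p g : Heisenberg} (hp : p ∈ Γ) (hg : normalCoord a b g = 0) {t : ℝ}
    (ht : p * g * horizontal a b t ∈ Γ) :
    t ^ 4 ≤ L ^ 4 * (12 * tangentCoord a b g ^ 4 + 64 * g.z ^ 2) := by
  have h4 := h.pow_four_le _ hp _ ht
  rw [mul_assoc, inv_mul_cancel_left, quarticNorm, sq_add_sq_eq hab, mul_horizontal_z hab,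
    normalCoord_mul, tangentCoord_mul, hg, normalCoord_horizontal hab, tangentCoord_horizontal,
    zero_add, add_zero] at h4
  set m := tangentCoord a b g
  have hL0 : 0 ≤ L ^ 4 := by positivity
  -- The term `6 * L ^ 4 * t ^ 4` is absorbed on the left by `12 * L ^ 4 ≤ 1`, which doubles the
  -- other constants.
  have h1 : (t ^ 2 + m ^ 2) ^ 2 + 16 * (g.z - t * m / 2) ^ 2 ≤
      6 * t ^ 4 + 6 * m ^ 4 + 32 * g.z ^ 2 := by
    nlinarith [sq_nonneg (g.z + t * m / 2), sq_nonneg (t ^ 2 - m ^ 2)]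
  have h2 := mul_le_mul_of_nonneg_left h1 hL0
  have h3 : 0 ≤ t ^ 4 := by positivity
  nlinarith

end IsEntireGraph

theorem horizontal_mul_sub (a b t : ℝ) (hab : a ^ 2 + b ^ 2 = 1) {h : Heisenberg}
    (hz : h.z = 0) (ht : normalCoord a b h = t) :
    normalCoord a b (horizontal a b (-t) * h) = 0 ∧
      tangentCoord a b (horizontal a b (-t) * h) = tangentCoord a b h ∧
      (horizontal a b (-t) * h).z = -(t * tangentCoord a b h) / 2 := by
  rw [normalCoord_mul, tangentCoord_mul, mul_z_eq hab, normalCoord_horizontal hab,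
    tangentCoord_horizontal, hz, ht, horizontal_z]
  refine ⟨by ring, by ring, by ring⟩

/-- One step of Newton's method towards a single graph. -/
theorem IsEntireGraph.exists_abs_le_half {a b L : ℝ} {Γ : Set Heisenberg}
    (hΓ : IsEntireGraph a b L Γ) (hab : a ^ 2 + b ^ 2 = 1) (hL : 12 * L ^ 4 ≤ 1) {K : ℝ}
    (hLK : L ^ 4 * (12 * K ^ 2 + 16 * K) ≤ 1 / 16) {p h : Heisenberg} {t ε : ℝ} (hz : h.z = 0)
    (ht : p * horizontal a b t ∈ Γ) (hht : normalCoord a b h = t) (htε : |t| ≤ ε)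
    (hh : h.x ^ 2 + h.y ^ 2 ≤ K * ε ^ 2) :
    ∃ s, |s| ≤ ε / 2 ∧ p * h * horizontal a b s ∈ Γ := by
  obtain ⟨s, hs⟩ := hΓ.exists_mem (p * h)
  refine ⟨s, ?_, hs⟩
  obtain ⟨g1, g2, g3⟩ := horizontal_mul_sub a b t hab hz hht
  -- Rebase at the graph point: the remaining factor is tangential to the plane, with height of
  -- second order.
  have e : p * h = p * horizontal a b t * (horizontal a b (-t) * h) := by
    rw [horizontal_neg]; group
  rw [e] at hs
  have h4 := hΓ.pow_four_le_of_normalCoord_eq_zero hab hL ht g1 hs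
  rw [g2, g3] at h4
  rw [sq_add_sq_eq hab] at hh
  set m := tangentCoord a b h
  have hε : 0 ≤ ε := (abs_nonneg t).trans htε
  have hm : m ^ 2 ≤ K * ε ^ 2 := by nlinarith [sq_nonneg (normalCoord a b h)]
  have ht2 : t ^ 2 ≤ ε ^ 2 := sq_le_sq' (abs_le.1 htε).1 (abs_le.1 htε).2
  have hm4 : m ^ 4 ≤ (K * ε ^ 2) ^ 2 := by nlinarith [sq_nonneg m]
  have htm : t ^ 2 * m ^ 2 ≤ ε ^ 2 * (K * ε ^ 2) :=
    mul_le_mul ht2 hm (sq_nonneg _) (sq_nonneg _)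
  have hb : 12 * m ^ 4 + 64 * (-(t * m) / 2) ^ 2 ≤ (12 * K ^ 2 + 16 * K) * ε ^ 4 := by
    nlinarith
  have h5 : s ^ 4 ≤ (ε / 2) ^ 4 := by
    have := mul_le_mul_of_nonneg_left hb (by positivity : 0 ≤ L ^ 4)
    have := mul_le_mul_of_nonneg_right hLK (by positivity : 0 ≤ ε ^ 4)
    nlinarith
  rw [← Even.pow_abs (by decide : Even 4) s] at h5
  exact (pow_le_pow_iff_left₀ (abs_nonneg _) (by positivity) four_ne_zero).1 h5

/-- `p` is within `ε` of `Γ` along the line in the direction `(a, b)`. -/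
def IsNear (a b : ℝ) (Γ : Set Heisenberg) (p : Heisenberg) (ε : ℝ) : Prop :=
  ∃ t, |t| ≤ ε ∧ p * horizontal a b t ∈ Γ

theorem mem_of_tendsto_isNear {a b : ℝ} {Γ : Set Heisenberg} (hΓ : IsClosed Γ)
    {p : ℕ → Heisenberg} {q : Heisenberg} (hp : Tendsto p atTop (𝓝 q)) {ε : ℕ → ℝ}
    (hε : Tendsto ε atTop (𝓝 0)) (h : ∀ n, IsNear a b Γ (p n) (ε n)) : q ∈ Γ := by
  choose t ht hmem using h
  have ht0 : Tendsto t atTop (𝓝 0) := squeeze_zero_norm ht hε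
  have h1 := hp.mul (((continuous_horizontal a b).tendsto 0).comp ht0)
  rw [horizontal_zero, mul_one] at h1
  exact hΓ.mem_of_tendsto h1 (Eventually.of_forall hmem)

section TwoGraphs

variable {a₁ b₁ a₂ b₂ L : ℝ} {Γ₁ Γ₂ : Set Heisenberg} (h₁ : a₁ ^ 2 + b₁ ^ 2 = 1)
  (h₂ : a₂ ^ 2 + b₂ ^ 2 = 1) (hΓ₁ : IsEntireGraph a₁ b₁ L Γ₁) (hΓ₂ : IsEntireGraph a₂ b₂ L Γ₂)
  (hL : 12 * L ^ 4 ≤ 1) {κ : ℝ} (hκ : 0 < κ)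
  (hLκ : L ^ 4 * (12 * (κ ^ 2) ^ 2 + 16 * κ ^ 2) ≤ 1 / 16)
  (hD : 4 ≤ κ ^ 2 * (a₁ * b₂ - a₂ * b₁) ^ 2)
include h₁ h₂ hΓ₁ hΓ₂ hL hκ hLκ hD

/-- One step of Newton's method. -/
theorem exists_newton_step {p : Heisenberg} {ε : ℝ}
    (hp₁ : IsNear a₁ b₁ Γ₁ p ε) (hp₂ : IsNear a₂ b₂ Γ₂ p ε) :
    ∃ h : Heisenberg, h.z = 0 ∧ |h.x| ≤ κ * ε ∧ |h.y| ≤ κ * ε ∧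
      IsNear a₁ b₁ Γ₁ (p * h) (ε / 2) ∧ IsNear a₂ b₂ Γ₂ (p * h) (ε / 2) := by
  obtain ⟨t₁, ht₁, hm₁⟩ := hp₁
  obtain ⟨t₂, ht₂, hm₂⟩ := hp₂
  set D := a₁ * b₂ - a₂ * b₁ with hDdef
  have hD0 : D ≠ 0 := by rintro h0; rw [h0] at hD; norm_num at hD
  have hε : 0 ≤ ε := (abs_nonneg _).trans ht₁
  -- Cramer's rule: the horizontal vector with normal coordinates `t₁` and `t₂`.
  let h : Heisenberg := ⟨(t₁ * b₂ - t₂ * b₁) / D, (t₂ * a₁ - t₁ * a₂) / D, 0⟩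
  have hn₁ : normalCoord a₁ b₁ h = t₁ := by
    change a₁ * ((t₁ * b₂ - t₂ * b₁) / D) + b₁ * ((t₂ * a₁ - t₁ * a₂) / D) = t₁
    field_simp
    rw [hDdef]; ring
  have hn₂ : normalCoord a₂ b₂ h = t₂ := by
    change a₂ * ((t₁ * b₂ - t₂ * b₁) / D) + b₂ * ((t₂ * a₁ - t₁ * a₂) / D) = t₂
    field_simp
    rw [hDdef]; ring
  have hh : h.x ^ 2 + h.y ^ 2 ≤ κ ^ 2 * ε ^ 2 := by
    have e := sq_add_sq_mul_det_sq_le h₁ h₂ h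
    rw [hn₁, hn₂, ← hDdef] at e
    have e₁ : t₁ ^ 2 ≤ ε ^ 2 := sq_le_sq' (abs_le.1 ht₁).1 (abs_le.1 ht₁).2
    have e₂ : t₂ ^ 2 ≤ ε ^ 2 := sq_le_sq' (abs_le.1 ht₂).1 (abs_le.1 ht₂).2
    have e₃ := mul_le_mul_of_nonneg_left e (sq_nonneg κ)
    have e₄ := mul_le_mul_of_nonneg_left (add_le_add e₁ e₂) (sq_nonneg κ)
    have e₅ := mul_le_mul_of_nonneg_right hD (add_nonneg (sq_nonneg h.x) (sq_nonneg h.y))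
    nlinarith
  refine ⟨h, rfl, abs_le_of_sq_le_sq ?_ (by positivity), abs_le_of_sq_le_sq ?_ (by positivity),
    hΓ₁.exists_abs_le_half h₁ hL hLκ rfl hm₁ hn₁ ht₁ hh,
    hΓ₂.exists_abs_le_half h₂ hL hLκ rfl hm₂ hn₂ ht₂ hh⟩
  · nlinarith [sq_nonneg h.y]
  · nlinarith [sq_nonneg h.x]

/-- Newton's method: a point near both graphs is near a point of the intersection. -/
theorem exists_mem_inter_of_isNear {p : Heisenberg} {ε : ℝ} (hε : 0 ≤ ε)
    (hp₁ : IsNear a₁ b₁ Γ₁ p ε) (hp₂ : IsNear a₂ b₂ Γ₂ p ε) :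
    ∃ g : Heisenberg, |g.x| ≤ 2 * κ * ε ∧ |g.y| ≤ 2 * κ * ε ∧ |g.z| ≤ 4 * κ ^ 2 * ε ^ 2 ∧
      p * g ∈ Γ₁ ∩ Γ₂ := by
  -- The factors `1 - (1 / 2) ^ n` are partial sums of the geometric series of step sizes. Height
  -- accumulates only through the symplectic terms, at most `2 κ² ε² / 2 ^ n` per step.
  let P : ℕ → Heisenberg → Prop := fun n g =>
    (|g.x| ≤ 2 * κ * ε * (1 - (1 / 2) ^ n) ∧ |g.y| ≤ 2 * κ * ε * (1 - (1 / 2) ^ n) ∧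
      |g.z| ≤ 4 * κ ^ 2 * ε ^ 2 * (1 - (1 / 2) ^ n)) ∧
    IsNear a₁ b₁ Γ₁ (p * g) (ε * (1 / 2) ^ n) ∧ IsNear a₂ b₂ Γ₂ (p * g) (ε * (1 / 2) ^ n)
  have hP : ∀ n, ∃ g, P n g := by
    intro n
    induction n with
    | zero => exact ⟨1, by simp, by simpa using hp₁, by simpa using hp₂⟩
    | succ n ih =>
      obtain ⟨g, ⟨hx, hy, hz⟩, hn₁, hn₂⟩ := ih
      obtain ⟨h, hhz, hhx, hhy, hm₁, hm₂⟩ :=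
        exists_newton_step h₁ h₂ hΓ₁ hΓ₂ hL hκ hLκ hD hn₁ hn₂
      have hu : (0 : ℝ) < (1 / 2) ^ n := by positivity
      have hpow : ((1 : ℝ) / 2) ^ (n + 1) = (1 / 2) ^ n / 2 := by rw [pow_succ]; ring
      rw [mul_assoc, mul_div_assoc, ← hpow] at hm₁ hm₂
      refine ⟨g * h, ⟨?_, ?_, ?_⟩, hm₁, hm₂⟩
      · rw [mul_x, hpow]
        refine (abs_add_le _ _).trans ((add_le_add hx hhx).trans (le_of_eq ?_))
        ring
      · rw [mul_y, hpow]
        refine (abs_add_le _ _).trans ((add_le_add hy hhy).trans (le_of_eq ?_))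
        ring
      · have hκε : 0 ≤ 2 * κ * ε := by positivity
        have hle : 2 * κ * ε * (1 - (1 / 2) ^ n) ≤ 2 * κ * ε :=
          mul_le_of_le_one_right hκε (by linarith)
        have b₁' : |g.x * h.y| ≤ 2 * κ * ε * (κ * (ε * (1 / 2) ^ n)) := by
          rw [abs_mul]; exact mul_le_mul (hx.trans hle) hhy (abs_nonneg _) hκε
        have b₂' : |h.x * g.y| ≤ 2 * κ * ε * (κ * (ε * (1 / 2) ^ n)) := by
          rw [abs_mul, mul_comm]; exact mul_le_mul (hy.trans hle) hhx (abs_nonneg _) hκε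
        rw [mul_z, hhz, hpow]
        rw [abs_le] at *
        constructor <;> nlinarith
  choose g hg using hP
  have hle : ∀ n : ℕ, (1 - (1 / 2 : ℝ) ^ n) ≤ 1 := fun n => by
    linarith [(by positivity : (0 : ℝ) < (1 / 2) ^ n)]
  set R := max (2 * κ * ε) (4 * κ ^ 2 * ε ^ 2)
  have hxy : 0 ≤ 2 * κ * ε := by positivity
  have hz : 0 ≤ 4 * κ ^ 2 * ε ^ 2 := by positivity
  let B : Set Heisenberg :=
    {g | |g.x| ≤ 2 * κ * ε ∧ |g.y| ≤ 2 * κ * ε ∧ |g.z| ≤ 4 * κ ^ 2 * ε ^ 2}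
  have hB : IsCompact B := by
    refine (isCompact_box 1 R).of_isClosed_subset ?_ fun q hq => ?_
    · exact (isClosed_le continuous_x.abs continuous_const).inter
        ((isClosed_le continuous_y.abs continuous_const).inter
          (isClosed_le continuous_z.abs continuous_const))
    · simp only [inv_one, one_mul, Set.mem_ofPred_eq]
      exact ⟨hq.1.trans (le_max_left _ _), hq.2.1.trans (le_max_left _ _),
        hq.2.2.trans (le_max_right _ _)⟩
  have : FirstCountableTopology Heisenberg :=
    coordsHomeomorph.isInducing.firstCountableTopology
  obtain ⟨q, hq, φ, hφ, hlim⟩ := hB.tendsto_subseq (x := g) fun n =>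
    ⟨(hg n).1.1.trans (mul_le_of_le_one_right hxy (hle n)),
      (hg n).1.2.1.trans (mul_le_of_le_one_right hxy (hle n)),
      (hg n).1.2.2.trans (mul_le_of_le_one_right hz (hle n))⟩
  have hlim' : Tendsto (fun n => p * g (φ n)) atTop (𝓝 (p * q)) := hlim.const_mul p
  have hε0 : Tendsto (fun n => ε * (1 / 2 : ℝ) ^ φ n) atTop (𝓝 0) := by
    have h := ((tendsto_pow_atTop_nhds_zero_of_lt_one (by norm_num : (0 : ℝ) ≤ 1 / 2)
      (by norm_num)).comp hφ.tendsto_atTop).const_mul ε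
    rwa [mul_zero] at h
  have hL1 : L ^ 4 < 1 := by linarith [(by positivity : 0 ≤ L ^ 4)]
  exact ⟨q, hq.1, hq.2.1, hq.2.2,
    mem_of_tendsto_isNear (hΓ₁.isClosed h₁ hL1) hlim' hε0 fun n => (hg (φ n)).2.1,
    mem_of_tendsto_isNear (hΓ₂.isClosed h₂ hL1) hlim' hε0 fun n => (hg (φ n)).2.2⟩

/-- The contraction is scale invariant, so Newton's method may start at the identity with any
initial error. -/
theorem nonempty_inter : (Γ₁ ∩ Γ₂).Nonempty := by
  obtain ⟨t₁, ht₁⟩ := hΓ₁.exists_mem 1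
  obtain ⟨t₂, ht₂⟩ := hΓ₂.exists_mem 1
  obtain ⟨g, -, -, -, hg⟩ := exists_mem_inter_of_isNear h₁ h₂ hΓ₁ hΓ₂ hL hκ hLκ hD
    (ε := max |t₁| |t₂|) (le_max_of_le_left (abs_nonneg _)) ⟨t₁, le_max_left _ _, ht₁⟩
    ⟨t₂, le_max_right _ _, ht₂⟩
  exact ⟨_, hg⟩

/-- The intersection has points at approximately every height. -/
theorem exists_mem_inter_abs_z_sub_le (hLκ' : 256 * κ ^ 2 * L ^ 2 ≤ 1) {p : Heisenberg}
    (hp : p ∈ Γ₁ ∩ Γ₂) (s : ℝ) :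
    ∃ e ∈ Γ₁ ∩ Γ₂, |(p⁻¹ * e).z - s| ≤ |s| / 8 := by
  -- After a vertical move by `s` the graph bound reads `t ^ 4 ≤ 64 L ^ 4 s ^ 2 = ε ^ 4`. Newton
  -- then changes the height by at most `4 κ² ε² = 32 κ² L² |s|`.
  set ε := √(8 * L ^ 2 * |s|) with hε
  have hε2 : ε ^ 2 = 8 * L ^ 2 * |s| := Real.sq_sqrt (by positivity)
  let c : Heisenberg := ⟨0, 0, s⟩
  have key : ∀ {a b : ℝ} {Γ : Set Heisenberg}, a ^ 2 + b ^ 2 = 1 → IsEntireGraph a b L Γ →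
      p ∈ Γ → IsNear a b Γ (p * c) ε := by
    intro a b Γ hab hΓ hpΓ
    obtain ⟨t, ht⟩ := hΓ.exists_mem (p * c)
    have h4 := hΓ.pow_four_le_of_normalCoord_eq_zero hab hL hpΓ
      (by simp [normalCoord, c] : normalCoord a b c = 0) ht
    rw [show tangentCoord a b c = 0 by simp [tangentCoord, c], show c.z = s from rfl] at h4
    refine ⟨t, ?_, ht⟩
    rw [← pow_le_pow_iff_left₀ (abs_nonneg _) (Real.sqrt_nonneg _) four_ne_zero,
      Even.pow_abs (by decide)]
    refine h4.trans (le_of_eq ?_)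
    rw [show ε ^ 4 = (ε ^ 2) ^ 2 by ring, hε2, ← sq_abs s]
    ring
  obtain ⟨g, -, -, hgz, hg⟩ := exists_mem_inter_of_isNear h₁ h₂ hΓ₁ hΓ₂ hL hκ hLκ hD
    (Real.sqrt_nonneg _) (key h₁ hΓ₁ hp.1) (key h₂ hΓ₂ hp.2)
  refine ⟨_, hg, ?_⟩
  rw [mul_assoc, inv_mul_cancel_left, mul_z]
  simp only [c, zero_mul, sub_self, mul_zero, add_zero, add_sub_cancel_left]
  rw [← hε, hε2] at hgz
  nlinarith [mul_le_mul_of_nonneg_right hLκ' (abs_nonneg s)]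

end TwoGraphs

/-! ### Connectedness of vertical curves with points at every height -/

section Connected

variable {E : Set Heisenberg} (hE : IsVerticalCurve 4 E)
  (hs : ∀ p ∈ E, ∀ s : ℝ, ∃ e ∈ E, |(p⁻¹ * e).z - s| ≤ |s| / 8)
include hs

theorem hasNoEndpoints_of_exists_height : HasNoEndpoints E := by
  rintro p ⟨hp, h | h⟩
  · obtain ⟨e, he, hez⟩ := hs p hp (-1)
    rw [abs_neg, abs_one] at hez
    have hneg : (p⁻¹ * e).z < 0 := by linarith [(abs_le.1 hez).2]
    have hne : e ≠ p := by rintro rfl; simp at hneg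
    have : 0 < (p⁻¹ * e).z := h e he hne
    linarith
  · obtain ⟨e, he, hez⟩ := hs p hp 1
    rw [abs_one] at hez
    have hpos : 0 < (p⁻¹ * e).z := by linarith [(abs_le.1 hez).1]
    have hne : e ≠ p := by rintro rfl; simp at hpos
    have : 0 < (e⁻¹ * p).z := h e he hne
    rw [inv_mul_z_comm] at this
    linarith

include hE

/-- Aim at half the height. The error of one eighth and the symplectic term, small because the
steepness is 4, leave all inequalities strict. -/
theorem exists_between {p q : Heisenberg} (hp : p ∈ E) (hq : q ∈ E) (hpq : 0 < (p⁻¹ * q).z) :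
    ∃ e ∈ E, 0 < (p⁻¹ * e).z ∧ (p⁻¹ * e).z < (p⁻¹ * q).z ∧ 0 < (e⁻¹ * q).z ∧
      (e⁻¹ * q).z < (p⁻¹ * q).z := by
  obtain ⟨e, he, hez⟩ := hs p hp ((p⁻¹ * q).z / 2)
  have hE' := isVerticalCurve_iff.1 hE
  rw [abs_of_pos (half_pos hpq), abs_le] at hez
  have hsym := abs_symplectic_le (by norm_num) (hE' e he p hp) (hE' p hp q hq)
  have hmul : (e⁻¹ * q).z = (e⁻¹ * p * (p⁻¹ * q)).z := by congr 1; group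
  rw [mul_z (e⁻¹ * p)] at hmul
  have hpe : 0 < (p⁻¹ * e).z := by linarith
  rw [inv_mul_z_comm p e] at hsym hmul
  rw [abs_neg, abs_of_pos hpe, abs_of_pos hpq] at hsym
  have := abs_le.1 (by linarith : |(e⁻¹ * p).x * (p⁻¹ * q).y - (p⁻¹ * q).x * (e⁻¹ * p).y| ≤
    ((p⁻¹ * e).z + (p⁻¹ * q).z) / 8)
  exact ⟨e, he, hpe, by linarith, by linarith, by linarith⟩

/-- The order interval `I` from `a` to `b` is compact, so some pair in `S` and `T` minimizes the
height difference. If it is nonzero, a point between them belongs to `S` or `T` and yields a closer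
pair. The minimizers may come in either order. -/
theorem false_of_disjoint_closed_cover (hcl : IsClosed E) {S T : Set Heisenberg}
    (hS : IsClosed S) (hT : IsClosed T) (hST : E ⊆ S ∪ T) (hdis : ¬(E ∩ (S ∩ T)).Nonempty)
    {a b : Heisenberg} (ha : a ∈ E ∩ S) (hb : b ∈ E ∩ T) (hab : 0 < (a⁻¹ * b).z) : False := by
  have hE1 : IsVerticalCurve 1 E := hE.of_le (by norm_num)
  have hcone := isVerticalCurve_iff.1 hE1
  have htrans : ∀ p ∈ E, ∀ q ∈ E, ∀ r ∈ E, 0 ≤ (p⁻¹ * q).z → 0 ≤ (q⁻¹ * r).z →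
      ((p⁻¹ * q).z + (q⁻¹ * r).z) / 2 ≤ (p⁻¹ * r).z := by
    intro p hp q hq r hr h1 h2
    have h := half_add_le_mul_z (σ := 1) (by simp) (hcone p hp q hq) (hcone q hq r hr)
      (by simpa using h1) (by simpa using h2)
    rw [show p⁻¹ * q * (q⁻¹ * r) = p⁻¹ * r by group] at h
    simpa using h
  let I : Set Heisenberg := {q | q ∈ E ∧ 0 ≤ (a⁻¹ * q).z ∧ 0 ≤ (q⁻¹ * b).z}
  have hcb : Continuous fun q : Heisenberg => (q⁻¹ * b).z :=
    continuous_z.comp (continuous_inv.mul continuous_const)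
  have hIcl : IsClosed I := hcl.inter
    ((isClosed_le continuous_const (continuous_inv_mul_z a)).inter
      (isClosed_le continuous_const hcb))
  have hI : IsCompact I := by
    refine hE1.isCompact_setOf_abs_z_le hIcl (fun q hq => hq.1) ha.1 (M := 2 * (a⁻¹ * b).z)
      fun q hq => ?_
    rw [abs_of_nonneg hq.2.1]
    linarith [htrans a ha.1 q hq.1 b hb.1 hq.2.1 hq.2.2, hq.2.2]
  have hIbetween : ∀ p ∈ I, ∀ q ∈ I, ∀ e ∈ E, 0 ≤ (p⁻¹ * e).z → 0 ≤ (e⁻¹ * q).z → e ∈ I := by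
    intro p hp q hq e he h1 h2
    exact ⟨he, by linarith [htrans a ha.1 p hp.1 e he hp.2.1 h1, hp.2.1],
      by linarith [htrans e he q hq.1 b hb.1 h2 hq.2.2, hq.2.2]⟩
  have hcont : Continuous fun v : Heisenberg × Heisenberg => |(v.1⁻¹ * v.2).z| :=
    (continuous_z.comp (continuous_fst.inv.mul continuous_snd)).abs
  obtain ⟨⟨p, q⟩, ⟨⟨hp, hpS⟩, ⟨hq, hqT⟩⟩, hmin⟩ :=
    ((hI.inter_right hS).prod (hI.inter_right hT)).exists_isMinOn
      ⟨(a, b), ⟨⟨ha.1, by simp, hab.le⟩, ha.2⟩, ⟨⟨hb.1, hab.le, by simp⟩, hb.2⟩⟩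
      hcont.continuousOn
  have hmin' : ∀ p' ∈ I, ∀ q' ∈ I, p' ∈ S → q' ∈ T → |(p⁻¹ * q).z| ≤ |(p'⁻¹ * q').z| :=
    fun p' hp' q' hq' hp'S hq'T =>
      isMinOn_iff.1 hmin (p', q') ⟨⟨hp', hp'S⟩, ⟨hq', hq'T⟩⟩
  rcases lt_trichotomy 0 (p⁻¹ * q).z with h0 | h0 | h0
  · obtain ⟨e, he, h1, h2, h3, h4⟩ := exists_between hE hs hp.1 hq.1 h0
    have heI := hIbetween p hp q hq e he h1.le h3.le
    rcases hST he with h | h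
    · have := hmin' e heI q hq h hqT
      rw [abs_of_pos h0, abs_of_pos h3] at this
      linarith
    · have := hmin' p hp e heI hpS h
      rw [abs_of_pos h0, abs_of_pos h1] at this
      linarith
  · obtain rfl := eq_of_mem_vCone (hcone p hp.1 q hq.1) h0.symm
    exact hdis ⟨p, hp.1, hpS, hqT⟩
  · have h0' : 0 < (q⁻¹ * p).z := by rw [inv_mul_z_comm]; linarith
    obtain ⟨e, he, h1, h2, h3, h4⟩ := exists_between hE hs hq.1 hp.1 h0'
    have heI := hIbetween q hq p hp e he h1.le h3.le
    have habs : ∀ u v : Heisenberg, |(u⁻¹ * v).z| = |(v⁻¹ * u).z| := fun u v => by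
      rw [inv_mul_z_comm, abs_neg]
    rcases hST he with h | h
    · have := hmin' e heI q hq h hqT
      rw [habs p q, habs e q, abs_of_pos h0', abs_of_pos h1] at this
      linarith
    · have := hmin' p hp e heI hpS h
      rw [habs p q, habs p e, abs_of_pos h0', abs_of_pos h3] at this
      linarith

theorem isPreconnected_of_exists_height (hcl : IsClosed E) : IsPreconnected E := by
  rw [isPreconnected_closed_iff]
  rintro S T hS hT hST ⟨a, ha⟩ ⟨b, hb⟩
  by_contra hdis
  rcases lt_trichotomy 0 (a⁻¹ * b).z with h | h | h
  · exact false_of_disjoint_closed_cover hE hs hcl hS hT hST hdis ha hb h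
  · obtain rfl := eq_of_mem_vCone
      (isVerticalCurve_iff.1 (hE.of_le (by norm_num : (1 : ℝ) ≤ 4)) a ha.1 b hb.1) h.symm
    exact hdis ⟨a, ha.1, ha.2, hb.2⟩
  · refine false_of_disjoint_closed_cover hE hs hcl hT hS (Set.union_comm S T ▸ hST)
      (Set.inter_comm S T ▸ hdis) hb ha ?_
    rw [inv_mul_z_comm]
    linarith

end Connected

/-! ### Steepness of the intersection -/

theorem IsEntireGraph.isVerticalCurve_inter {a₁ b₁ a₂ b₂ L lam : ℝ} {Γ₁ Γ₂ : Set Heisenberg}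
    (hΓ₁ : IsEntireGraph a₁ b₁ L Γ₁) (hΓ₂ : IsEntireGraph a₂ b₂ L Γ₂)
    (h₁ : a₁ ^ 2 + b₁ ^ 2 = 1) (h₂ : a₂ ^ 2 + b₂ ^ 2 = 1)
    (hD : a₁ * b₂ - a₂ * b₁ ≠ 0)
    (hL : L ^ 4 * (16 * (1 + 16 * lam ^ 2)) ≤ (a₁ * b₂ - a₂ * b₁) ^ 4) :
    IsVerticalCurve lam (Γ₁ ∩ Γ₂) := by
  refine isVerticalCurve_iff.2 fun p hp q hq => ?_
  have g₁ := hΓ₁.pow_four_le p hp.1 q hq.1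
  have g₂ := hΓ₂.pow_four_le p hp.2 q hq.2
  set g := p⁻¹ * q
  have e := sq_add_sq_mul_det_sq_le h₁ h₂ g
  set m := normalCoord a₁ b₁ g
  set n := normalCoord a₂ b₂ g
  set D := a₁ * b₂ - a₂ * b₁
  rw [quarticNorm] at g₁ g₂
  change lam * (g.x ^ 2 + g.y ^ 2) ≤ |g.z|
  set r := g.x ^ 2 + g.y ^ 2
  have hr : 0 ≤ r := by positivity
  -- Square the transversality bound and use `(m² + n²)² ≤ 2 (m⁴ + n⁴)`, so that both cone
  -- inequalities apply.
  have e2 : D ^ 4 * r ^ 2 ≤ 16 * L ^ 4 * (r ^ 2 + 16 * g.z ^ 2) := by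
    have := pow_le_pow_left₀ (by positivity) e 2
    nlinarith [sq_nonneg (m ^ 2 - n ^ 2)]
  have hD4 : 0 < D ^ 4 := by positivity
  have e3 : (1 + 16 * lam ^ 2) * r ^ 2 ≤ r ^ 2 + 16 * g.z ^ 2 := by
    have f1 := mul_le_mul_of_nonneg_left e2 (by positivity : 0 ≤ 1 + 16 * lam ^ 2)
    have f2 := mul_le_mul_of_nonneg_right hL (by positivity : 0 ≤ r ^ 2 + 16 * g.z ^ 2)
    nlinarith
  exact (le_abs_self _).trans (sq_le_sq.1 (by nlinarith))

end Heisenberg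

/-! ### Choice of constants and conclusion -/

open Heisenberg
theorem theorem1p2 (W₁ W₂ : Subgroup Heisenberg) (hW₁ : IsVerticalPlane W₁)
    (hW₂ : IsVerticalPlane W₂) (hne : W₁ ≠ W₂) :
    ∃ lam₀ : ℝ, 0 < lam₀ ∧ ∀ lam : ℝ, lam₀ < lam →
      ∃ L L' : ℝ, 0 < L ∧ L < 1 ∧ 0 < L' ∧ L' < 1 ∧
        (∀ Γ₁ Γ₂ : Set Heisenberg,
          IsEntireILipGraph W₁ L Γ₁ → IsEntireILipGraph W₂ L Γ₂ →
            IsVerticalCurve lam (Γ₁ ∩ Γ₂) ∧ (Γ₁ ∩ Γ₂).Nonempty ∧ IsClosed (Γ₁ ∩ Γ₂) ∧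
              IsConnected (Γ₁ ∩ Γ₂) ∧ HasNoEndpoints (Γ₁ ∩ Γ₂)) ∧
        (∀ E : Set Heisenberg, IsVerticalCurve lam E →
          ∃ Γ₁ Γ₂ : Set Heisenberg,
            IsEntireILipGraph W₁ L' Γ₁ ∧ IsEntireILipGraph W₂ L' Γ₂ ∧
              (∃ lam' : ℝ, 0 < lam' ∧ IsVerticalCurve lam' (Γ₁ ∩ Γ₂)) ∧ E ⊆ Γ₁ ∩ Γ₂ ∧
              (E.Nonempty → IsClosed E → IsConnected E → HasNoEndpoints E →
                Γ₁ ∩ Γ₂ = E)) := by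
  obtain ⟨a₁, b₁, h₁, hmem₁⟩ := hW₁.exists_normal
  obtain ⟨a₂, b₂, h₂, hmem₂⟩ := hW₂.exists_normal
  have hD := det_normals_ne_zero hne h₁ h₂ hmem₁ hmem₂
  have hd1 := det_sq_le_one h₁ h₂
  obtain ⟨L', hL'0, hL'1, hL'⟩ := exists_entire_graphs_inter h₁ h₂ hmem₁ hmem₂ hD
  set D := a₁ * b₂ - a₂ * b₁ with hDdef
  have hd0 : 0 < D ^ 2 := by positivity
  refine ⟨5 / D ^ 2, by positivity, fun lam hlam => ?_⟩
  have hlam5 : 5 < lam := by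
    refine lt_of_le_of_lt ?_ hlam
    rw [le_div_iff₀ hd0]
    linarith
  -- The factor `1 + lam` gives steepness `lam`; since `lam > 5`, also `L ≤ D ^ 2 / 600`, small
  -- enough for Newton's method.
  set L := D ^ 2 / (100 * (1 + lam)) with hLdef
  have hL0 : 0 < L := by positivity
  have hLlam : L * (1 + lam) = D ^ 2 / 100 := by rw [hLdef]; field_simp
  have hLD : L ≤ D ^ 2 / 600 := by nlinarith
  have hL2 : L ^ 2 ≤ (D ^ 2) ^ 2 / 360000 := by nlinarith
  have hL4 : L ^ 4 ≤ (D ^ 2) ^ 4 / 360000 ^ 2 := by nlinarith [sq_nonneg L]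
  have hd2 : (D ^ 2) ^ 2 ≤ D ^ 2 := by nlinarith
  have hd4 : (D ^ 2) ^ 4 ≤ (D ^ 2) ^ 2 := pow_le_pow_of_le_one hd0.le hd1 (by norm_num)
  refine ⟨L, L', hL0, by linarith, hL'0, hL'1, fun Γ₁ Γ₂ hΓ₁ hΓ₂ => ?_, fun E hE => ?_⟩
  · rw [isEntireILipGraph_iff h₁ hmem₁ hL0.le] at hΓ₁
    rw [isEntireILipGraph_iff h₂ hmem₂ hL0.le] at hΓ₂
    have g₁ : IsEntireGraph a₁ b₁ L Γ₁ := ⟨hΓ₁.1, hΓ₁.2⟩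
    have g₂ : IsEntireGraph a₂ b₂ L Γ₂ := ⟨hΓ₂.1, hΓ₂.2⟩
    -- The Newton step has length at most `2 / |D|` times the error.
    have hκ : 0 < 2 / |D| := by positivity
    have hκ2 : (2 / |D|) ^ 2 = 4 / D ^ 2 := by rw [div_pow, sq_abs]; norm_num
    have hL12 : 12 * L ^ 4 ≤ 1 := by linarith
    have hLκ : L ^ 4 * (12 * ((2 / |D|) ^ 2) ^ 2 + 16 * (2 / |D|) ^ 2) ≤ 1 / 16 := by
      have e : 12 * ((2 / |D|) ^ 2) ^ 2 + 16 * (2 / |D|) ^ 2 ≤ 256 / (D ^ 2) ^ 2 := by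
        rw [hκ2, le_div_iff₀ (by positivity)]
        field_simp
        nlinarith
      refine (mul_le_mul_of_nonneg_left e (by positivity)).trans ?_
      rw [mul_div_assoc', div_le_iff₀ (by positivity)]
      linarith [sq_nonneg (D ^ 2)]
    have hDκ : 4 ≤ (2 / |D|) ^ 2 * (a₁ * b₂ - a₂ * b₁) ^ 2 := by
      rw [hκ2, ← hDdef, div_mul_cancel₀ _ hd0.ne']
    have hLκ' : 256 * (2 / |D|) ^ 2 * L ^ 2 ≤ 1 := by
      rw [hκ2, mul_div_assoc', div_mul_eq_mul_div, div_le_one hd0]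
      linarith
    have hvc : IsVerticalCurve lam (Γ₁ ∩ Γ₂) := by
      refine g₁.isVerticalCurve_inter g₂ h₁ h₂ hD ?_
      have e1 : 16 * (1 + 16 * lam ^ 2) ≤ 256 * (1 + lam) ^ 4 := by
        have : (1 + lam) ^ 2 ≤ (1 + lam) ^ 4 := pow_le_pow_right₀ (by linarith) (by norm_num)
        nlinarith
      have e2 : L ^ 4 * (1 + lam) ^ 4 = (D ^ 2) ^ 4 / 100 ^ 4 := by
        rw [← mul_pow, hLlam, div_pow]
      have e3 := mul_le_mul_of_nonneg_left e1 (by positivity : 0 ≤ L ^ 4)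
      rw [← hDdef, show D ^ 4 = (D ^ 2) ^ 2 by ring]
      nlinarith
    have hcl : IsClosed (Γ₁ ∩ Γ₂) :=
      (g₁.isClosed h₁ (by linarith)).inter (g₂.isClosed h₂ (by linarith))
    have hnonempty := nonempty_inter h₁ h₂ g₁ g₂ hL12 hκ hLκ hDκ
    have hheight := fun p hp s =>
      exists_mem_inter_abs_z_sub_le h₁ h₂ g₁ g₂ hL12 hκ hLκ hDκ hLκ' (p := p) hp s
    exact ⟨hvc, hnonempty, hcl,
      ⟨hnonempty, isPreconnected_of_exists_height (hvc.of_le (by linarith)) hheight hcl⟩,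
      hasNoEndpoints_of_exists_height hheight⟩
  · rcases E.eq_empty_or_nonempty with rfl | hEne
    -- The cone construction needs a nonempty set; for empty `E` a single point serves.
    · obtain ⟨Γ₁, Γ₂, g₁, g₂, hv, -⟩ := hL' lam hlam.le {1}
        (isVerticalCurve_iff.2 (by simp [vCone])) (Set.singleton_nonempty 1)
      exact ⟨Γ₁, Γ₂, g₁, g₂, ⟨1, one_pos, hv⟩, Set.empty_subset _,
        fun h => absurd h Set.not_nonempty_empty⟩
    · obtain ⟨Γ₁, Γ₂, g₁, g₂, hv, hsub⟩ := hL' lam hlam.le E hE hEne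
      exact ⟨Γ₁, Γ₂, g₁, g₂, ⟨1, one_pos, hv⟩, hsub,
        fun _ hcl hconn hend => hv.eq_of_subset hsub hcl hconn hend⟩
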